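/- Let $\alpha\in(0,2)\setminus\{1\}$ and let $c_-,c_+\ge 0$ be not both zero. Let $X=(X_t)_{t\ge0}$, $X_0=0$, be a strictly $\alpha$-stable process with parameters $c_-,c_+$, that is, a real-valued Lévy process with $X_{ct}\stackrel{d}{=}c^{1/\alpha}X_t$ for all $c>0$, $t\ge 0$, and with Lévy measure $\nu(dh)=\bigl(c_-\mathbf 1_{\{h<0\}}+c_+\mathbf 1_{\{h>0\}}\bigr)|h|^{-\alpha-1}\,dh$. Its infinitesimal generator is $\mathcal L\phi(x)=\lim_{t\downarrow0}t^{-1}\bigl(\mathbb E[\phi(x+X_t)]-\phi(x)\bigr)$, the limit being uniform in $x\in\mathbb R$. Let $\Phi$ be the Lizorkin space, i.e. the space of (complex-valued) Schwartz functions $\phi$ on $\mathbb R$ whose Fourier transform vanishes at $0$ together with all its derivatives. For $\beta>0$ and $\phi\in\Phi$ let $$I_-^\beta\phi(x)=\frac1{\Gamma(\beta)}\int_{-\infty}^x(x-t)^{\beta-1}\phi(t)\,dt,\qquad I_+^\beta\phi(x)=\frac1{\Gamma(\beta)}\int_x^\infty(t-x)^{\beta-1}\phi(t)\,dt$$ be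 the left and right Riemann–Liouville fractional integrals and, with $n=\lceil\alpha\rceil$, let $$D_-^\alpha\phi=\frac{d^n}{dx^n}I_-^{n-\alpha}\phi,\qquad D_+^\alpha\phi=(-1)^n\frac{d^n}{dx^n}I_+^{n-\alpha}\phi$$ be the left and right fractional derivatives (the integrals converge absolutely and the derivatives exist). Put $M_\pm=c_\pm\Gamma(-\alpha)$ and $$K_\pm=\frac{M_\pm}{M_-^2+M_+^2+2M_-M_+\cos(\pi\alpha)}.$$ Then every $\phi\in\Phi$ is in the domain of $\mathcal L$, with $\mathcal L\phi=M_-D_-^\alpha\phi+M_+D_+^\alpha\phi$, and $\mathcal L$ is a linear bijection of $\Phi$ onto $\Phi$ whose inverse is $$\mathcal L^{-1}\phi(x)=K_-I_-^\alpha\phi(x)+K_+I_+^\alpha\phi(x)\qquad(\phi\in\Phi,\ x\in\mathbb R).$$ Moreover, $\mathcal L$ maps the real-valued functions in $\Phi$ bijectively onto themselves. -/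

import Mathlib

open MeasureTheory ProbabilityTheory Filter Topology Set
open scoped NNReal SchwartzMap FourierTransform

noncomputable section

/-! ### Lévy processes and strictly stable processes -/

/-- `X` is a real-valued Lévy process under `P`: it starts at zero, has independent and stationary
increments, and almost surely has right-continuous paths with left limits. -/
structure IsLevyProcess {Ω : Type*} [MeasurableSpace Ω] (X : ℝ≥0 → Ω → ℝ) (P : Measure Ω) :
    Prop where
  measurable : ∀ t, Measurable (X t)
  start_zero : ∀ᵐ ω ∂P, X 0 ω = 0
  indep_increments : HasIndepIncrements X P
  stationary_increments : ∀ s t : ℝ≥0, P.map (fun ω => X (s + t) ω - X s ω) = P.map (X t)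
  right_continuous : ∀ᵐ ω ∂P, ∀ t, ContinuousWithinAt (fun s => X s ω) (Ici t) t
  left_limits : ∀ᵐ ω ∂P, ∀ t, ∃ l : ℝ, Tendsto (fun s => X s ω) (𝓝[<] t) (𝓝 l)

/-- The characteristic exponent with generating triplet `(a, ν, b)`, where `a` is the Gaussian
variance, `ν` the jump measure and `b` the drift for the truncation of jumps at size one. -/
def levyKhintchineExponent (a b : ℝ) (ν : Measure ℝ) (u : ℝ) : ℂ :=
  Complex.I * b * u - a * u ^ 2 / 2 +
    ∫ h, (Complex.exp (Complex.I * u * h) - 1 -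
      (if |h| ≤ 1 then Complex.I * u * h else 0)) ∂ν

/-- `ν` is the Lévy measure of the Lévy process `X`: it is the jump measure of the generating
triplet of `X`. -/
def HasLevyMeasure {Ω : Type*} [MeasurableSpace Ω] (X : ℝ≥0 → Ω → ℝ) (P : Measure Ω)
    (ν : Measure ℝ) : Prop :=
  ν {0} = 0 ∧ (∫⁻ h, ENNReal.ofReal (min 1 (h ^ 2)) ∂ν) < ⊤ ∧
    ∃ a b : ℝ, 0 ≤ a ∧ ∀ (t : ℝ≥0) (u : ℝ),
      charFun (P.map (X t)) u = Complex.exp ((t : ℝ) * levyKhintchineExponent a b ν u)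

/-- The measure `(c₋ 1_{h < 0} + c₊ 1_{h > 0}) |h|^{-α-1} dh` on the real line. -/
def stableLevyMeasure (α cneg cpos : ℝ) : Measure ℝ :=
  volume.withDensity fun h => ENNReal.ofReal
    (((if h < 0 then cneg else 0) + (if 0 < h then cpos else 0)) / |h| ^ (α + 1))

/-- `X` is a strictly `α`-stable Lévy process with jump parameters `c₋` and `c₊`. -/
structure IsStrictlyStable {Ω : Type*} [MeasurableSpace Ω] (X : ℝ≥0 → Ω → ℝ) (P : Measure Ω)
    (α cneg cpos : ℝ) : Prop where
  levy : IsLevyProcess X P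
  scaling : ∀ (c t : ℝ≥0), 0 < c →
    P.map (X (c * t)) = P.map (fun ω => (c : ℝ) ^ (1 / α) * X t ω)
  levyMeasure : HasLevyMeasure X P (stableLevyMeasure α cneg cpos)

/-- `f` is in the domain of the infinitesimal generator of `X` and the generator maps it to `g`:
the difference quotients `(E f(x + X_t) - f(x)) / t` converge to `g(x)` as `t ↓ 0`,
uniformly in `x`, that is, in the supremum norm. -/
def HasGenerator {Ω : Type*} [MeasurableSpace Ω] (X : ℝ≥0 → Ω → ℝ) (P : Measure Ω)
    (f g : ℝ → ℂ) : Prop :=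
  TendstoUniformly
    (fun (t : ℝ≥0) (x : ℝ) => ((∫ ω, f (x + X t ω) ∂P) - f x) / ((t : ℝ) : ℂ)) g (𝓝[>] 0)

/-! ### Riemann–Liouville fractional operators -/

/-- The integrand of the left fractional integral of order `β` at `x`. -/
def leftKernel (β : ℝ) (f : ℝ → ℂ) (x t : ℝ) : ℂ := (((x - t) ^ (β - 1) : ℝ) : ℂ) * f t

/-- The integrand of the right fractional integral of order `β` at `x`. -/
def rightKernel (β : ℝ) (f : ℝ → ℂ) (x t : ℝ) : ℂ := (((t - x) ^ (β - 1) : ℝ) : ℂ) * f t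

/-- The left fractional integral `I₋^β` of order `β ≥ 0` (the identity for `β = 0`). -/
def leftFracInt (β : ℝ) (f : ℝ → ℂ) (x : ℝ) : ℂ :=
  if β = 0 then f x else ((1 / Real.Gamma β : ℝ) : ℂ) * ∫ t in Iio x, leftKernel β f x t

/-- The right fractional integral `I₊^β` of order `β ≥ 0` (the identity for `β = 0`). -/
def rightFracInt (β : ℝ) (f : ℝ → ℂ) (x : ℝ) : ℂ :=
  if β = 0 then f x else ((1 / Real.Gamma β : ℝ) : ℂ) * ∫ t in Ioi x, rightKernel β f x t

/-- The left fractional derivative `D₋^β` of order `β > 0`, with `n - 1 < β ≤ n`. -/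
def leftFracDeriv (β : ℝ) (f : ℝ → ℂ) (x : ℝ) : ℂ :=
  iteratedDeriv ⌈β⌉₊ (leftFracInt (⌈β⌉₊ - β) f) x

/-- The right fractional derivative `D₊^β` of order `β > 0`, with `n - 1 < β ≤ n`. -/
def rightFracDeriv (β : ℝ) (f : ℝ → ℂ) (x : ℝ) : ℂ :=
  (-1) ^ ⌈β⌉₊ * iteratedDeriv ⌈β⌉₊ (rightFracInt (⌈β⌉₊ - β) f) x

/-! ### The Lizorkin space -/

/-- The space `Ψ` of Schwartz functions that vanish at zero together with all derivatives. -/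
def lizorkinPsi : Submodule ℂ 𝓢(ℝ, ℂ) where
  carrier := {ψ | ∀ j : ℕ, iteratedDeriv j (ψ : ℝ → ℂ) 0 = 0}
  zero_mem' := fun j => by
    change iteratedDeriv j (fun _ : ℝ => (0 : ℂ)) 0 = 0
    simp
  add_mem' := fun {f g} hf hg j => by
    change iteratedDeriv j ((f : ℝ → ℂ) + (g : ℝ → ℂ)) 0 = 0
    rw [iteratedDeriv_add ((f.smooth j).contDiffAt) ((g.smooth j).contDiffAt), hf j, hg j,
      add_zero]
  smul_mem' := fun c f hf j => by
    change iteratedDeriv j (c • (f : ℝ → ℂ)) 0 = 0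
    rw [iteratedDeriv_const_smul ((f.smooth j).contDiffAt) c, hf j, smul_zero]

/-- The Lizorkin space `Φ`: the Schwartz functions whose Fourier transform is in `Ψ`. (Mathlib's
Fourier transform is `∫ exp(-2πiux) f(x) dx`; as it differs from `∫ exp(iux) f(x) dx` only by a
dilation and a reflection of the variable, both give the same space.) -/
def lizorkin : Submodule ℂ 𝓢(ℝ, ℂ) where
  carrier := {φ | 𝓕 φ ∈ lizorkinPsi}
  zero_mem' := by
    change FourierTransform.fourierCLM ℂ 𝓢(ℝ, ℂ) 0 ∈ lizorkinPsi
    rw [map_zero]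
    exact lizorkinPsi.zero_mem
  add_mem' := fun {f g} hf hg => by
    change FourierTransform.fourierCLM ℂ 𝓢(ℝ, ℂ) (f + g) ∈ lizorkinPsi
    rw [map_add]
    exact lizorkinPsi.add_mem hf hg
  smul_mem' := fun c f hf => by
    change FourierTransform.fourierCLM ℂ 𝓢(ℝ, ℂ) (c • f) ∈ lizorkinPsi
    rw [map_smul]
    exact lizorkinPsi.smul_mem c hf

/-! ### The constants -/

/-- The constant `M = c Γ(-α)` attached to a jump parameter `c`. -/
def stableM (α c : ℝ) : ℝ := c * Real.Gamma (-α)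

/-- The common denominator `M₋² + M₊² + 2 M₋ M₊ cos(πα)`. -/
def stableDenom (α cneg cpos : ℝ) : ℝ :=
  stableM α cneg ^ 2 + stableM α cpos ^ 2 +
    2 * stableM α cneg * stableM α cpos * Real.cos (Real.pi * α)

/-- The constant `K₋`. -/
def stableKneg (α cneg cpos : ℝ) : ℝ := stableM α cneg / stableDenom α cneg cpos

/-- The constant `K₊`. -/
def stableKpos (α cneg cpos : ℝ) : ℝ := stableM α cpos / stableDenom α cneg cpos

end

/-!
On the Fourier side every operator of the statement is multiplication by a symbol of the form
`a ξ^s` for `ξ > 0` and `b |ξ|^s` for `ξ < 0`, called `homSymbol a b s` below. The space `Ψ` of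
Schwartz functions which are flat at the origin is stable under multiplication by such symbols for
every real `s`: flatness and rapid decay absorb any power of `|ξ|`, of either sign, and the derivative
of a symbol is a symbol again. Conjugating with the Fourier transform gives the multiplier
operators `homMultiplier a b s` of the Lizorkin space, which compose by multiplying coefficients
and adding exponents.

Fractional integration of order `β` is the multiplier `(±2πiξ)^{-β}` (`integral_rpow_mul_lizorkin`).
This follows, for all `β > 0` at once, from the Laplace transform of a power on the right half-plane,
after damping the kernel by `exp(-εs)`; flatness at the origin permits the limit `ε → 0`. Hence the
fractional derivatives are the multipliers `(±2πiξ)^α`.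

The law of `X_t` has the characteristic function `exp(t (M₋ (iu)^α + M₊ (-iu)^α))`
(`IsStrictlyStable.charFun_eq`). The jump part of the Lévy–Khintchine exponent is computed by partial
integration from the Laplace transform, and the remaining drift and Gaussian part is excluded by the
scaling relation, as it is a combination of `u` and `u²` while `α ≠ 1, 2`. By Fourier inversion
the generator is therefore the multiplier with symbol `M₋ (2πiξ)^α + M₊ (-2πiξ)^α`
(`hasGenerator_homMultiplier`).

The two values of `(±2πi)^α` have quotient `exp(±πiα)`, so multiplying this symbol with
`M₋ (2πiξ)^{-α} + M₊ (-2πiξ)^{-α}` gives the constant `M₋² + M₊² + 2 M₋ M₊ cos(πα)`, which is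
positive because `α ≠ 1` and the jump parameters are not both zero. This is the inversion formula
(`fracMultiplier_comp_eq_id`). Real functions stay real, since the generator is a limit of real difference quotients and the inverse is a real
combination of fractional integrals.
-/

noncomputable section

/-! ### Homogeneous symbols -/

/-- The homogeneous symbol `a ξ^s` on the positive and `b |ξ|^s` on the negative half-line. Its value
at the origin is set to zero, which is harmless since it only multiplies functions vanishing there. -/
def homSymbol (a b : ℂ) (s ξ : ℝ) : ℂ :=
  if 0 < ξ then a * ((ξ ^ s : ℝ) : ℂ) else if ξ < 0 then b * (((-ξ) ^ s : ℝ) : ℂ) else 0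

theorem homSymbol_of_pos {a b : ℂ} {s ξ : ℝ} (h : 0 < ξ) :
    homSymbol a b s ξ = a * ((ξ ^ s : ℝ) : ℂ) := by
  simp [homSymbol, h]

theorem homSymbol_of_neg {a b : ℂ} {s ξ : ℝ} (h : ξ < 0) :
    homSymbol a b s ξ = b * (((-ξ) ^ s : ℝ) : ℂ) := by
  simp [homSymbol, h, h.not_gt]

@[simp]
theorem homSymbol_zero (a b : ℂ) (s : ℝ) : homSymbol a b s 0 = 0 := by
  simp [homSymbol]

theorem homSymbol_mul (a b a' b' : ℂ) (s s' ξ : ℝ) :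
    homSymbol a b s ξ * homSymbol a' b' s' ξ = homSymbol (a * a') (b * b') (s + s') ξ := by
  rcases lt_trichotomy ξ 0 with h | rfl | h
  · rw [homSymbol_of_neg h, homSymbol_of_neg h, homSymbol_of_neg h,
      Real.rpow_add (neg_pos.2 h)]
    push_cast
    ring
  · simp
  · rw [homSymbol_of_pos h, homSymbol_of_pos h, homSymbol_of_pos h, Real.rpow_add h]
    push_cast
    ring

theorem homSymbol_add (a b a' b' : ℂ) (s ξ : ℝ) :
    homSymbol (a + a') (b + b') s ξ = homSymbol a b s ξ + homSymbol a' b' s ξ := by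
  rcases lt_trichotomy ξ 0 with h | rfl | h
  · simp only [homSymbol_of_neg h]; ring
  · simp
  · simp only [homSymbol_of_pos h]; ring

theorem homSymbol_const_mul (c a b : ℂ) (s ξ : ℝ) :
    homSymbol (c * a) (c * b) s ξ = c * homSymbol a b s ξ := by
  rcases lt_trichotomy ξ 0 with h | rfl | h
  · simp only [homSymbol_of_neg h]; ring
  · simp
  · simp only [homSymbol_of_pos h]; ring

theorem norm_homSymbol_le (a b : ℂ) (s ξ : ℝ) :
    ‖homSymbol a b s ξ‖ ≤ (‖a‖ + ‖b‖) * |ξ| ^ s := by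
  rcases lt_trichotomy ξ 0 with h | rfl | h
  · rw [homSymbol_of_neg h, norm_mul, Complex.norm_real, abs_of_neg h,
      Real.norm_of_nonneg (Real.rpow_nonneg (neg_nonneg.2 h.le) _)]
    gcongr
    · exact Real.rpow_nonneg (neg_nonneg.2 h.le) _
    · simp
  · simp only [homSymbol_zero, norm_zero]
    positivity
  · rw [homSymbol_of_pos h, norm_mul, Complex.norm_real, abs_of_pos h,
      Real.norm_of_nonneg (Real.rpow_nonneg h.le _)]
    gcongr
    simp

theorem hasDerivAt_homSymbol (a b : ℂ) (s : ℝ) {ξ : ℝ} (hξ : ξ ≠ 0) :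
    HasDerivAt (homSymbol a b s) (homSymbol (a * s) (-(b * s)) (s - 1) ξ) ξ := by
  rcases lt_or_gt_of_ne hξ with h | h
  · have h1 : HasDerivAt (fun y : ℝ => (-y) ^ s) (s * (-ξ) ^ (s - 1) * (-1)) ξ := by
      have h2 := Real.hasDerivAt_rpow_const (x := -ξ) (p := s) (Or.inl (neg_ne_zero.2 hξ))
      exact h2.comp ξ (hasDerivAt_neg ξ)
    have h3 := h1.ofReal_comp.const_mul b
    rw [homSymbol_of_neg h]
    refine (h3.congr_of_eventuallyEq ?_).congr_deriv ?_
    · filter_upwards [gt_mem_nhds h] with y hy using homSymbol_of_neg hy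
    · push_cast; ring
  · have h1 := Real.hasDerivAt_rpow_const (x := ξ) (p := s) (Or.inl hξ)
    have h3 := h1.ofReal_comp.const_mul a
    rw [homSymbol_of_pos h]
    refine (h3.congr_of_eventuallyEq ?_).congr_deriv ?_
    · filter_upwards [lt_mem_nhds h] with y hy using homSymbol_of_pos hy
    · push_cast; ring

/-! ### Multiplication of flat Schwartz functions by homogeneous symbols -/

theorem lizorkinPsi_apply_zero {ψ : 𝓢(ℝ, ℂ)} (hψ : ψ ∈ lizorkinPsi) : ψ 0 = 0 := by
  simpa using hψ 0

theorem derivCLM_mem_lizorkinPsi {ψ : 𝓢(ℝ, ℂ)} (hψ : ψ ∈ lizorkinPsi) :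
    SchwartzMap.derivCLM ℂ ℂ ψ ∈ lizorkinPsi := by
  intro j
  have h := hψ (j + 1)
  rw [iteratedDeriv_succ'] at h
  exact h

theorem exists_norm_le_mul_abs_pow (N : ℕ) {ψ : 𝓢(ℝ, ℂ)} (hψ : ψ ∈ lizorkinPsi) :
    ∃ C, 0 ≤ C ∧ ∀ ξ : ℝ, ‖ψ ξ‖ ≤ C * |ξ| ^ N := by
  induction N generalizing ψ with
  | zero =>
    exact ⟨_, apply_nonneg _ _, fun ξ => by simpa using SchwartzMap.norm_le_seminorm ℝ ψ ξ⟩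
  | succ N ih =>
    obtain ⟨C, hC, h⟩ := ih (derivCLM_mem_lizorkinPsi hψ)
    refine ⟨C, hC, fun ξ => ?_⟩
    have h1 := Convex.norm_image_sub_le_of_norm_hasDerivWithin_le (f := ψ) (f' := deriv ψ)
      (s := Icc (-|ξ|) |ξ|) (C := C * |ξ| ^ N) (x := 0) (y := ξ)
      (fun y _ => (ψ.hasDerivAt y).hasDerivWithinAt)
      (fun y hy => (h y).trans
        (mul_le_mul_of_nonneg_left (pow_le_pow_left₀ (abs_nonneg y) (abs_le.2 hy) N) hC))
      (convex_Icc _ _)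
      (by simp) ⟨neg_abs_le ξ, le_abs_self ξ⟩
    rw [lizorkinPsi_apply_zero hψ, sub_zero, sub_zero, Real.norm_eq_abs] at h1
    rwa [pow_succ, ← mul_assoc]

/-- A function in `Ψ` beats every power of `|ξ|`, of either sign, at infinity and at the origin. -/
theorem exists_rpow_mul_norm_le (s : ℝ) {ψ : 𝓢(ℝ, ℂ)} (hψ : ψ ∈ lizorkinPsi) :
    ∃ C, 0 ≤ C ∧ ∀ ξ : ℝ, |ξ| ^ s * ‖ψ ξ‖ ≤ C := by
  obtain ⟨N, hN⟩ := exists_nat_ge |s|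
  obtain ⟨C, hC, h⟩ := exists_norm_le_mul_abs_pow N hψ
  obtain ⟨D, hD⟩ := ψ.decay' N 0
  have hD' : ∀ ξ : ℝ, |ξ| ^ N * ‖ψ ξ‖ ≤ D := fun ξ => by
    have := hD ξ
    rwa [norm_iteratedFDeriv_zero] at this
  have hD0 : 0 ≤ D := le_trans (by positivity) (hD' 0)
  refine ⟨C + D, by positivity, fun ξ => ?_⟩
  rcases eq_or_ne ξ 0 with rfl | hξ
  · simp only [lizorkinPsi_apply_zero hψ, norm_zero, mul_zero]
    positivity
  have hpos : 0 < |ξ| := abs_pos.2 hξ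
  rcases le_total |ξ| 1 with h1 | h1
  · have h2 : |ξ| ^ s ≤ |ξ| ^ (-(N : ℝ)) :=
      Real.rpow_le_rpow_of_exponent_ge hpos h1 (by linarith [neg_abs_le s])
    calc |ξ| ^ s * ‖ψ ξ‖ ≤ |ξ| ^ (-(N : ℝ)) * (C * |ξ| ^ N) := by gcongr; exact h ξ
      _ = C := by
        rw [Real.rpow_neg hpos.le, Real.rpow_natCast]
        field_simp
      _ ≤ C + D := by linarith
  · have h2 : |ξ| ^ s ≤ |ξ| ^ (N : ℝ) :=
      Real.rpow_le_rpow_of_exponent_le h1 ((le_abs_self s).trans hN)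
    rw [Real.rpow_natCast] at h2
    calc |ξ| ^ s * ‖ψ ξ‖ ≤ |ξ| ^ N * ‖ψ ξ‖ := by gcongr
      _ ≤ C + D := by linarith [hD' ξ]

theorem hasDerivAt_homSymbol_mul (a b : ℂ) (s : ℝ) {ψ : 𝓢(ℝ, ℂ)} (hψ : ψ ∈ lizorkinPsi) (ξ : ℝ) :
    HasDerivAt (fun ξ => homSymbol a b s ξ * ψ ξ)
      (homSymbol (a * s) (-(b * s)) (s - 1) ξ * ψ ξ +
        homSymbol a b s ξ * SchwartzMap.derivCLM ℂ ℂ ψ ξ) ξ := by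
  rcases eq_or_ne ξ 0 with rfl | hξ
  · -- At the origin the product is `O(ξ²)`, so its derivative vanishes, and so does the right side.
    obtain ⟨C, hC, h⟩ := exists_rpow_mul_norm_le (s - 2) hψ
    have hO : (fun ξ => homSymbol a b s ξ * ψ ξ) =O[𝓝 0] fun ξ : ℝ => ‖ξ - 0‖ ^ 2 := by
      refine Asymptotics.IsBigO.of_bound ((‖a‖ + ‖b‖) * C) (Eventually.of_forall fun ξ => ?_)
      rcases eq_or_ne ξ 0 with rfl | hξ
      · simp
      have hpos : 0 < |ξ| := abs_pos.2 hξ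
      have h2 : |ξ| ^ s = |ξ| ^ (s - 2) * |ξ| ^ 2 := by
        rw [← Real.rpow_natCast, ← Real.rpow_add hpos]
        norm_num
      rw [norm_mul, sub_zero, norm_pow, norm_norm, Real.norm_eq_abs]
      calc ‖homSymbol a b s ξ‖ * ‖ψ ξ‖ ≤ (‖a‖ + ‖b‖) * |ξ| ^ s * ‖ψ ξ‖ := by
            gcongr; exact norm_homSymbol_le a b s ξ
        _ = (‖a‖ + ‖b‖) * (|ξ| ^ (s - 2) * ‖ψ ξ‖) * |ξ| ^ 2 := by rw [h2]; ring
        _ ≤ (‖a‖ + ‖b‖) * C * |ξ| ^ 2 := by gcongr; exact h ξ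
    have h3 := (hO.hasFDerivAt one_lt_two).hasDerivAt
    simpa using h3
  · exact (hasDerivAt_homSymbol a b s hξ).mul (ψ.hasDerivAt ξ)

theorem contDiff_homSymbol_mul (n : ℕ) (a b : ℂ) (s : ℝ) {ψ : 𝓢(ℝ, ℂ)} (hψ : ψ ∈ lizorkinPsi) :
    ContDiff ℝ n (fun ξ => homSymbol a b s ξ * ψ ξ) := by
  induction n generalizing a b s ψ with
  | zero =>
    exact contDiff_zero.2 (continuous_iff_continuousAt.2 fun ξ =>
      (hasDerivAt_homSymbol_mul a b s hψ ξ).continuousAt)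
  | succ n ih =>
    push_cast
    refine contDiff_succ_iff_deriv.2
      ⟨fun ξ => (hasDerivAt_homSymbol_mul a b s hψ ξ).differentiableAt, by simp, ?_⟩
    rw [funext fun ξ => (hasDerivAt_homSymbol_mul a b s hψ ξ).deriv]
    exact (ih _ _ _ hψ).add (ih _ _ _ (derivCLM_mem_lizorkinPsi hψ))

theorem deriv_homSymbol_mul (a b : ℂ) (s : ℝ) {ψ : 𝓢(ℝ, ℂ)} (hψ : ψ ∈ lizorkinPsi) :
    deriv (fun ξ => homSymbol a b s ξ * ψ ξ) =
      (fun ξ => homSymbol (a * s) (-(b * s)) (s - 1) ξ * ψ ξ) +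
        fun ξ => homSymbol a b s ξ * SchwartzMap.derivCLM ℂ ℂ ψ ξ :=
  funext fun ξ => (hasDerivAt_homSymbol_mul a b s hψ ξ).deriv

theorem iteratedDeriv_homSymbol_mul_zero (n : ℕ) (a b : ℂ) (s : ℝ) {ψ : 𝓢(ℝ, ℂ)}
    (hψ : ψ ∈ lizorkinPsi) :
    iteratedDeriv n (fun ξ => homSymbol a b s ξ * ψ ξ) 0 = 0 := by
  induction n generalizing a b s ψ with
  | zero => simp
  | succ n ih =>
    rw [iteratedDeriv_succ', deriv_homSymbol_mul a b s hψ,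
      iteratedDeriv_add (contDiff_homSymbol_mul n _ _ _ hψ).contDiffAt
        (contDiff_homSymbol_mul n _ _ _ (derivCLM_mem_lizorkinPsi hψ)).contDiffAt,
      ih _ _ _ hψ, ih _ _ _ (derivCLM_mem_lizorkinPsi hψ), add_zero]

theorem decay_homSymbol_mul (k n : ℕ) (a b : ℂ) (s : ℝ) {ψ : 𝓢(ℝ, ℂ)}
    (hψ : ψ ∈ lizorkinPsi) :
    ∃ C, ∀ x : ℝ, |x| ^ k * ‖iteratedDeriv n (fun ξ => homSymbol a b s ξ * ψ ξ) x‖ ≤ C := by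
  induction n generalizing a b s ψ with
  | zero =>
    obtain ⟨C, hC, h⟩ := exists_rpow_mul_norm_le (k + s) hψ
    refine ⟨(‖a‖ + ‖b‖) * C, fun x => ?_⟩
    rw [iteratedDeriv_zero, norm_mul]
    rcases eq_or_ne x 0 with rfl | hx
    · simp only [homSymbol_zero, norm_zero, zero_mul, mul_zero]
      positivity
    calc |x| ^ k * (‖homSymbol a b s x‖ * ‖ψ x‖)
        ≤ |x| ^ k * ((‖a‖ + ‖b‖) * |x| ^ s * ‖ψ x‖) := by
          gcongr; exact norm_homSymbol_le a b s x
      _ = (‖a‖ + ‖b‖) * (|x| ^ ((k : ℝ) + s) * ‖ψ x‖) := by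
          rw [Real.rpow_add (abs_pos.2 hx), Real.rpow_natCast]; ring
      _ ≤ (‖a‖ + ‖b‖) * C := by gcongr; exact h x
  | succ n ih =>
    obtain ⟨C, hC⟩ := ih (a * s) (-(b * s)) (s - 1) hψ
    obtain ⟨D, hD⟩ := ih a b s (derivCLM_mem_lizorkinPsi hψ)
    refine ⟨C + D, fun x => ?_⟩
    rw [iteratedDeriv_succ', deriv_homSymbol_mul a b s hψ,
      iteratedDeriv_add (contDiff_homSymbol_mul n _ _ _ hψ).contDiffAt
        (contDiff_homSymbol_mul n _ _ _ (derivCLM_mem_lizorkinPsi hψ)).contDiffAt]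
    calc _ ≤ |x| ^ k * (_ + _) := by gcongr; exact norm_add_le _ _
      _ ≤ C + D := by rw [mul_add]; exact add_le_add (hC x) (hD x)

/-- Multiplication by a homogeneous symbol, as a linear operator of the space `Ψ`. -/
def psiMul (a b : ℂ) (s : ℝ) : lizorkinPsi →ₗ[ℂ] lizorkinPsi where
  toFun ψ := ⟨
    { toFun := fun ξ => homSymbol a b s ξ * (ψ : 𝓢(ℝ, ℂ)) ξ
      smooth' := contDiff_infty.2 fun n => contDiff_homSymbol_mul n a b s ψ.2
      decay' := fun k n => by
        obtain ⟨C, hC⟩ := decay_homSymbol_mul k n a b s ψ.2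
        refine ⟨C, fun x => ?_⟩
        rw [norm_iteratedFDeriv_eq_norm_iteratedDeriv]
        exact hC x },
    fun j => iteratedDeriv_homSymbol_mul_zero j a b s ψ.2⟩
  map_add' ψ₁ ψ₂ := by
    ext ξ
    exact mul_add _ _ _
  map_smul' c ψ := by
    ext ξ
    exact mul_left_comm _ _ _

@[simp]
theorem psiMul_apply (a b : ℂ) (s : ℝ) (ψ : lizorkinPsi) (ξ : ℝ) :
    (psiMul a b s ψ : 𝓢(ℝ, ℂ)) ξ = homSymbol a b s ξ * (ψ : 𝓢(ℝ, ℂ)) ξ :=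
  rfl

/-! ### Fourier multipliers of the Lizorkin space -/

/-- The Fourier transform as an isomorphism of the Lizorkin space `Φ` onto `Ψ`. -/
def lizorkinFourier : lizorkin ≃ₗ[ℂ] lizorkinPsi where
  toFun φ := ⟨𝓕 (φ : 𝓢(ℝ, ℂ)), φ.2⟩
  invFun ψ := ⟨𝓕⁻ (ψ : 𝓢(ℝ, ℂ)), by
    change 𝓕 (𝓕⁻ (ψ : 𝓢(ℝ, ℂ))) ∈ lizorkinPsi
    rw [FourierTransform.fourier_fourierInv_eq]
    exact ψ.2⟩
  map_add' φ₁ φ₂ := Subtype.ext (FourierTransform.fourier_add _ _)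
  map_smul' c φ := Subtype.ext (FourierTransform.fourier_smul _ _)
  left_inv φ := Subtype.ext (FourierTransform.fourierInv_fourier_eq _)
  right_inv ψ := Subtype.ext (FourierTransform.fourier_fourierInv_eq _)

/-- The Fourier multiplier operator of `Φ` with symbol `homSymbol a b s`. -/
def homMultiplier (a b : ℂ) (s : ℝ) : lizorkin →ₗ[ℂ] lizorkin :=
  lizorkinFourier.symm.toLinearMap ∘ₗ psiMul a b s ∘ₗ lizorkinFourier.toLinearMap

theorem fourierInv_eq_integral (ψ : 𝓢(ℝ, ℂ)) (x : ℝ) :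
    (𝓕⁻ ψ : 𝓢(ℝ, ℂ)) x = ∫ ξ : ℝ, Complex.exp (2 * Real.pi * Complex.I * ξ * x) * ψ ξ := by
  rw [SchwartzMap.fourierInv_coe, Real.fourierInv_eq']
  refine integral_congr_ae (Eventually.of_forall fun ξ => ?_)
  simp only [smul_eq_mul, RCLike.inner_apply, conj_trivial]
  congr 2
  push_cast
  ring

theorem lizorkin_eq_integral (φ : lizorkin) (x : ℝ) :
    (φ : 𝓢(ℝ, ℂ)) x = ∫ ξ : ℝ, Complex.exp (2 * Real.pi * Complex.I * ξ * x) *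
      (lizorkinFourier φ : 𝓢(ℝ, ℂ)) ξ := by
  rw [← fourierInv_eq_integral]
  exact DFunLike.congr_fun (FourierTransform.fourierInv_fourier_eq (φ : 𝓢(ℝ, ℂ))).symm x

theorem homMultiplier_apply (a b : ℂ) (s : ℝ) (φ : lizorkin) (x : ℝ) :
    (homMultiplier a b s φ : 𝓢(ℝ, ℂ)) x =
      ∫ ξ : ℝ, Complex.exp (2 * Real.pi * Complex.I * ξ * x) *
        (homSymbol a b s ξ * (lizorkinFourier φ : 𝓢(ℝ, ℂ)) ξ) :=
  fourierInv_eq_integral _ x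

theorem integrable_homSymbol_mul (a b : ℂ) (s : ℝ) (ψ : lizorkinPsi) :
    Integrable fun ξ => homSymbol a b s ξ * (ψ : 𝓢(ℝ, ℂ)) ξ :=
  (psiMul a b s ψ : 𝓢(ℝ, ℂ)).integrable

theorem psiMul_psiMul (a b a' b' : ℂ) (s s' : ℝ) (ψ : lizorkinPsi) :
    psiMul a b s (psiMul a' b' s' ψ) = psiMul (a * a') (b * b') (s + s') ψ := by
  ext ξ
  simp only [psiMul_apply]
  rw [← mul_assoc, homSymbol_mul]

theorem homMultiplier_homMultiplier (a b a' b' : ℂ) (s s' : ℝ) (φ : lizorkin) :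
    homMultiplier a b s (homMultiplier a' b' s' φ) =
      homMultiplier (a * a') (b * b') (s + s') φ := by
  simp [homMultiplier, psiMul_psiMul]

theorem homMultiplier_one (φ : lizorkin) : homMultiplier 1 1 0 φ = φ := by
  have h : psiMul 1 1 0 (lizorkinFourier φ) = lizorkinFourier φ := by
    ext ξ
    rw [psiMul_apply]
    rcases lt_trichotomy ξ 0 with h | rfl | h
    · simp [homSymbol_of_neg h]
    · rw [lizorkinPsi_apply_zero (lizorkinFourier φ).2, mul_zero]
    · simp [homSymbol_of_pos h]
  simp [homMultiplier, h]

theorem homMultiplier_add (a b a' b' : ℂ) (s : ℝ) (φ : lizorkin) :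
    homMultiplier (a + a') (b + b') s φ = homMultiplier a b s φ + homMultiplier a' b' s φ := by
  have h : psiMul (a + a') (b + b') s (lizorkinFourier φ) =
      psiMul a b s (lizorkinFourier φ) + psiMul a' b' s (lizorkinFourier φ) := by
    ext ξ
    simp [homSymbol_add, add_mul]
  simp [homMultiplier, h]

theorem homMultiplier_const_mul (c a b : ℂ) (s : ℝ) (φ : lizorkin) :
    homMultiplier (c * a) (c * b) s φ = c • homMultiplier a b s φ := by
  have h : psiMul (c * a) (c * b) s (lizorkinFourier φ) =
      c • psiMul a b s (lizorkinFourier φ) := by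
    ext ξ
    simp [homSymbol_const_mul, mul_assoc]
  simp [homMultiplier, h]

/-- Differentiation is the multiplier with symbol `2πiξ`. -/
theorem deriv_lizorkin (φ : lizorkin) :
    deriv (φ : 𝓢(ℝ, ℂ)) =
      (homMultiplier (2 * Real.pi * Complex.I) (-(2 * Real.pi * Complex.I)) 1 φ : 𝓢(ℝ, ℂ)) := by
  have h := SchwartzMap.lineDerivOp_fourierInv_eq (lizorkinFourier φ : 𝓢(ℝ, ℂ)) (1 : ℝ)
  have h1 : 𝓕⁻ (lizorkinFourier φ : 𝓢(ℝ, ℂ)) = φ := FourierTransform.fourierInv_fourier_eq _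
  rw [h1] at h
  have h2 : (2 * Real.pi * Complex.I) • (SchwartzMap.smulLeftCLM ℂ fun x : ℝ => inner ℝ x (1 : ℝ))
      (lizorkinFourier φ : 𝓢(ℝ, ℂ)) =
      psiMul (2 * Real.pi * Complex.I) (-(2 * Real.pi * Complex.I)) 1 (lizorkinFourier φ) := by
    ext ξ
    have hg : (fun x : ℝ => inner ℝ x (1 : ℝ)).HasTemperateGrowth := by fun_prop
    rw [psiMul_apply, smul_apply, SchwartzMap.smulLeftCLM_apply_apply hg]
    rcases lt_trichotomy ξ 0 with h | rfl | h
    · simp [homSymbol_of_neg h, mul_assoc]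
    · simp
    · simp [homSymbol_of_pos h, mul_assoc]
  rw [h2] at h
  ext x
  have h3 := DFunLike.congr_fun h x
  rw [SchwartzMap.lineDerivOp_apply_eq_fderiv] at h3
  exact h3

theorem iteratedDeriv_lizorkin (n : ℕ) (φ : lizorkin) :
    iteratedDeriv n (φ : 𝓢(ℝ, ℂ)) =
      (homMultiplier ((2 * Real.pi * Complex.I) ^ n) ((-(2 * Real.pi * Complex.I)) ^ n) n φ :
        𝓢(ℝ, ℂ)) := by
  induction n generalizing φ with
  | zero => simp [homMultiplier_one]
  | succ n ih =>
    rw [iteratedDeriv_succ', deriv_lizorkin, ih, homMultiplier_homMultiplier, pow_succ, pow_succ]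
    push_cast
    rfl

/-! ### Complex powers and the Laplace transform of a power -/

theorem ofReal_mul_cpow {r : ℝ} (hr : 0 < r) {z : ℂ} (hz : z ≠ 0) (s : ℝ) :
    (z * r) ^ (s : ℂ) = z ^ (s : ℂ) * ((r ^ s : ℝ) : ℂ) := by
  have hr' : (r : ℂ) ≠ 0 := by exact_mod_cast hr.ne'
  rw [Complex.cpow_def_of_ne_zero (mul_ne_zero hz hr'), mul_comm z, Complex.log_ofReal_mul hr hz,
    Complex.ofReal_cpow hr.le, Complex.cpow_def_of_ne_zero hz, Complex.cpow_def_of_ne_zero hr',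
    ← Complex.exp_add, Complex.ofReal_log hr.le]
  ring_nf

/-- The symbol of a complex power: `(zξ)^s` is homogeneous on each half-line, with the
coefficients `z^s` and `(-z)^s`. -/
theorem homSymbol_cpow {z : ℂ} (hz : z ≠ 0) (s : ℝ) {ξ : ℝ} (hξ : ξ ≠ 0) :
    homSymbol (z ^ (s : ℂ)) ((-z) ^ (s : ℂ)) s ξ = (z * ξ) ^ (s : ℂ) := by
  rcases lt_or_gt_of_ne hξ with h | h
  · rw [homSymbol_of_neg h, ← ofReal_mul_cpow (neg_pos.2 h) (neg_ne_zero.2 hz)]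
    simp
  · rw [homSymbol_of_pos h, ofReal_mul_cpow h hz]

theorem norm_ofReal_mul_cexp {r t : ℝ} (hr : 0 ≤ r) (z : ℂ) :
    ‖(r : ℂ) * Complex.exp (-(z * t))‖ = r * Real.exp (-z.re * t) := by
  rw [norm_mul, Complex.norm_real, Complex.norm_exp, Real.norm_of_nonneg hr]
  simp

theorem measurable_rpow_mul_cexp (s : ℝ) (z : ℂ) :
    Measurable fun t : ℝ => ((t ^ s : ℝ) : ℂ) * Complex.exp (-(z * t)) := by
  fun_prop

theorem integrableOn_rpow_mul_cexp {s : ℝ} (hs : -1 < s) {z : ℂ} (hz : 0 < z.re) :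
    IntegrableOn (fun t : ℝ => ((t ^ s : ℝ) : ℂ) * Complex.exp (-(z * t))) (Ioi 0) := by
  have h := integrableOn_rpow_mul_exp_neg_mul_rpow hs one_pos hz
  refine Integrable.mono' h (measurable_rpow_mul_cexp s z).aestronglyMeasurable ?_
  filter_upwards [ae_restrict_mem measurableSet_Ioi] with t ht
  rw [norm_ofReal_mul_cexp (Real.rpow_nonneg (le_of_lt ht) s), Real.rpow_one]

theorem differentiableOn_integral_rpow_mul_cexp {β : ℝ} (hβ : 0 < β) :
    DifferentiableOn ℂ
      (fun z : ℂ => ∫ t in Ioi (0 : ℝ), ((t ^ (β - 1) : ℝ) : ℂ) * Complex.exp (-(z * t)))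
      {z | 0 < z.re} := by
  intro z hz
  have hz2 : 0 < z.re / 2 := half_pos hz
  have hb := integrableOn_rpow_mul_exp_neg_mul_rpow (s := β) (by linarith) one_pos hz2
  have hs : {w : ℂ | z.re / 2 < w.re} ∈ 𝓝 z :=
    (isOpen_lt continuous_const Complex.continuous_re).mem_nhds
      (show z.re / 2 < z.re from half_lt_self hz)
  refine (hasDerivAt_integral_of_dominated_loc_of_deriv_le (μ := volume.restrict (Ioi 0))
    (F' := fun (w : ℂ) (t : ℝ) => -(((t ^ β : ℝ) : ℂ) * Complex.exp (-(w * t)))) hs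
    (Eventually.of_forall fun w => (measurable_rpow_mul_cexp _ w).aestronglyMeasurable)
    (integrableOn_rpow_mul_cexp (by linarith) hz)
    (measurable_rpow_mul_cexp _ z).neg.aestronglyMeasurable ?_ hb
    ?_).2.differentiableAt.differentiableWithinAt
  · filter_upwards [ae_restrict_mem measurableSet_Ioi] with t ht w hw
    have ht' : 0 ≤ t := le_of_lt ht
    rw [norm_neg, norm_ofReal_mul_cexp (Real.rpow_nonneg ht' β), Real.rpow_one]
    gcongr
  · filter_upwards [ae_restrict_mem measurableSet_Ioi] with t ht w hw
    have h1 : HasDerivAt (fun w : ℂ => -(w * t)) (-(1 * (t : ℂ))) w :=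
      ((hasDerivAt_id w).mul_const _).neg
    refine (h1.cexp.const_mul ((t ^ (β - 1) : ℝ) : ℂ)).congr_deriv ?_
    have ht1 : t ^ β = t ^ (β - 1) * t := by
      rw [Real.rpow_sub_one (ne_of_gt ht), div_mul_cancel₀ _ (ne_of_gt ht)]
    rw [ht1]
    push_cast
    ring

/-- The Laplace transform of a power, for complex arguments in the right half-plane; it is the
analytic continuation of the formula on the positive real axis. -/
theorem integral_rpow_mul_cexp {β : ℝ} (hβ : 0 < β) {z : ℂ} (hz : 0 < z.re) :
    ∫ t in Ioi (0 : ℝ), ((t ^ (β - 1) : ℝ) : ℂ) * Complex.exp (-(z * t)) =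
      Real.Gamma β * z ^ ((-β : ℝ) : ℂ) := by
  have hU : IsOpen {z : ℂ | 0 < z.re} := isOpen_lt continuous_const Complex.continuous_re
  have hf := (differentiableOn_integral_rpow_mul_cexp hβ).analyticOnNhd hU
  have hg : AnalyticOnNhd ℂ (fun z : ℂ => (Real.Gamma β : ℂ) * z ^ ((-β : ℝ) : ℂ))
      {z | 0 < z.re} := by
    refine DifferentiableOn.analyticOnNhd (fun w hw => ?_) hU
    exact (((hasDerivAt_id w).cpow_const (Or.inl hw)).const_mul
      _).differentiableAt.differentiableWithinAt
  refine hf.eqOn_of_preconnected_of_frequently_eq hg (convex_halfSpace_re_gt 0).isPreconnected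
    (z₀ := 1) (by simp) ?_ hz
  have ht : Tendsto (fun r : ℝ => (r : ℂ)) (𝓝[≠] 1) (𝓝[≠] 1) := by
    refine tendsto_nhdsWithin_of_tendsto_nhds_of_eventually_within _ ?_ ?_
    · exact (Complex.continuous_ofReal.tendsto' 1 1 Complex.ofReal_one).mono_left
        nhdsWithin_le_nhds
    · filter_upwards [self_mem_nhdsWithin] with r hr
      simpa using hr
  refine ht.frequently (Eventually.frequently ?_)
  filter_upwards [nhdsWithin_le_nhds (lt_mem_nhds one_pos)] with r hr
  have h1 := Real.integral_rpow_mul_exp_neg_mul_Ioi hβ hr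
  rw [one_div, Real.inv_rpow (le_of_lt hr), ← Real.rpow_neg (le_of_lt hr)] at h1
  rw [← Complex.ofReal_cpow (le_of_lt hr), ← Complex.ofReal_mul, mul_comm, ← h1,
    ← integral_complex_ofReal]
  refine integral_congr_ae (Eventually.of_forall fun t => ?_)
  simp

/-! ### Fractional integrals and derivatives as Fourier multipliers -/

/-- The integrals defining fractional integrals of Schwartz functions converge. -/
theorem integrableOn_rpow_mul_schwartz {β : ℝ} (hβ : 0 < β) (φ : 𝓢(ℝ, ℂ)) (x : ℝ) {σ : ℝ}
    (hσ : σ ≠ 0) :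
    IntegrableOn (fun s : ℝ => ((s ^ (β - 1) : ℝ) : ℂ) * φ (x + σ * s)) (Ioi 0) := by
  let e : ℝ ≃L[ℝ] ℝ := ContinuousLinearEquiv.unitsEquivAut ℝ (Units.mk0 σ hσ)
  let g : 𝓢(ℝ, ℂ) := SchwartzMap.compCLMOfContinuousLinearEquiv ℂ e
    (SchwartzMap.compSubConstCLM ℂ (-x) φ)
  have hg : ∀ s, g s = φ (x + σ * s) := fun s => by
    simp [g, e, add_comm, mul_comm]
  have h := mellin_convergent_of_isBigO_scalar (f := fun s => ‖g s‖) (s := β) (a := β + 1) (b := 0)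
    (g.continuous.norm.locallyIntegrable.locallyIntegrableOn _) ?_ (by linarith) ?_ hβ
  · refine Integrable.mono' h ?_ ?_
    · refine Measurable.aestronglyMeasurable ?_
      have := φ.continuous.measurable
      fun_prop
    · filter_upwards [ae_restrict_mem measurableSet_Ioi] with s hs
      rw [norm_mul, Complex.norm_real, Real.norm_of_nonneg (Real.rpow_nonneg (le_of_lt hs) _), hg]
  · have h1 := (g.isBigO_cocompact_rpow (-(β + 1))).mono atTop_le_cocompact
    refine (h1.norm_left).congr' EventuallyEq.rfl ?_
    filter_upwards [eventually_ge_atTop 0] with s hs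
    rw [Real.norm_of_nonneg hs]
  · simp only [neg_zero, Real.rpow_zero]
    exact (g.continuous.norm.continuousAt.isBigO_one ℝ).mono nhdsWithin_le_nhds

theorem integral_rpow_mul_cexp_mul_lizorkin {β : ℝ} (hβ : 0 < β) (φ : lizorkin) (x σ : ℝ)
    {ε : ℝ} (hε : 0 < ε) :
    ∫ s in Ioi (0 : ℝ), (((s ^ (β - 1) : ℝ) : ℂ) * Complex.exp (-(ε * s))) *
        (φ : 𝓢(ℝ, ℂ)) (x + σ * s) =
      ∫ ξ : ℝ, Complex.exp (2 * Real.pi * Complex.I * ξ * x) *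
        (Real.Gamma β * (ε - 2 * Real.pi * Complex.I * σ * ξ) ^ ((-β : ℝ) : ℂ) *
          (lizorkinFourier φ : 𝓢(ℝ, ℂ)) ξ) := by
  set ψ : 𝓢(ℝ, ℂ) := (lizorkinFourier φ).1
  have hint := (integrableOn_rpow_mul_cexp (s := β - 1) (by linarith) (z := ε)
    (by simpa using hε)).mul_prod (ψ.integrable (μ := volume))
  have hint2 := hint.bdd_mul (c := 1)
    (f := fun p : ℝ × ℝ => Complex.exp (((2 * Real.pi * p.2 * (x + σ * p.1) : ℝ) : ℂ) * Complex.I))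
    (Measurable.aestronglyMeasurable (by fun_prop))
    (Eventually.of_forall fun p => (Complex.norm_exp_ofReal_mul_I _).le)
  have hswap := integral_integral_swap
    (f := fun (s ξ : ℝ) => Complex.exp (((2 * Real.pi * ξ * (x + σ * s) : ℝ) : ℂ) * Complex.I) *
      ((((s ^ (β - 1) : ℝ) : ℂ) * Complex.exp (-(ε * s))) * ψ ξ)) hint2
  calc _ = ∫ s in Ioi (0 : ℝ), ∫ ξ : ℝ,
        Complex.exp (((2 * Real.pi * ξ * (x + σ * s) : ℝ) : ℂ) * Complex.I) *
          ((((s ^ (β - 1) : ℝ) : ℂ) * Complex.exp (-(ε * s))) * ψ ξ) := by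
        refine integral_congr_ae (Eventually.of_forall fun s => ?_)
        simp only
        rw [lizorkin_eq_integral, ← integral_const_mul]
        refine integral_congr_ae (Eventually.of_forall fun ξ => ?_)
        simp only
        rw [show 2 * Real.pi * Complex.I * ξ * ((x + σ * s : ℝ) : ℂ) =
          ((2 * Real.pi * ξ * (x + σ * s) : ℝ) : ℂ) * Complex.I by push_cast; ring]
        ring
    _ = _ := hswap
    _ = _ := by
        refine integral_congr_ae (Eventually.of_forall fun ξ => ?_)
        simp only
        rw [← integral_rpow_mul_cexp hβ (z := ε - 2 * Real.pi * Complex.I * σ * ξ)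
          (by simpa using hε), ← integral_mul_const, ← integral_const_mul]
        refine integral_congr_ae (Eventually.of_forall fun s => ?_)
        simp only
        rw [show ((2 * Real.pi * ξ * (x + σ * s) : ℝ) : ℂ) * Complex.I =
            2 * Real.pi * Complex.I * ξ * x + 2 * Real.pi * Complex.I * σ * ξ * s by
              push_cast; ring,
          show -((ε - 2 * Real.pi * Complex.I * σ * ξ) * (s : ℂ)) =
            -(ε * s) + 2 * Real.pi * Complex.I * σ * ξ * s by ring,
          Complex.exp_add, Complex.exp_add]
        ring

/-- One-sided fractional integration of order `β` is the Fourier multiplier `(-2πiσξ)^{-β}` on the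
Lizorkin space. The kernel is damped by `exp(-εs)` to apply Fubini's theorem, and the symbol
stays integrable against the Fourier transform as `ε → 0` because the latter is flat at zero. -/
theorem integral_rpow_mul_lizorkin {β : ℝ} (hβ : 0 < β) (φ : lizorkin) (x : ℝ) {σ : ℝ}
    (hσ : σ ≠ 0) {z : ℂ} (hz : z = -(2 * Real.pi * Complex.I * σ)) :
    ∫ s in Ioi (0 : ℝ), ((s ^ (β - 1) : ℝ) : ℂ) * (φ : 𝓢(ℝ, ℂ)) (x + σ * s) =
      Real.Gamma β *
        (homMultiplier (z ^ ((-β : ℝ) : ℂ)) ((-z) ^ ((-β : ℝ) : ℂ)) (-β) φ : 𝓢(ℝ, ℂ)) x := by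
  have hz0 : z ≠ 0 := by
    rw [hz]
    simp [Real.pi_ne_zero, hσ]
  set ψ : 𝓢(ℝ, ℂ) := (lizorkinFourier φ).1
  set H : ℝ → ℂ := homSymbol (z ^ ((-β : ℝ) : ℂ)) ((-z) ^ ((-β : ℝ) : ℂ)) (-β) with hH
  have hφm : Measurable (φ : 𝓢(ℝ, ℂ)) := (φ : 𝓢(ℝ, ℂ)).continuous.measurable
  have hψm : Measurable ψ := ψ.continuous.measurable
  have hleft : Tendsto (fun ε : ℝ => ∫ s in Ioi (0 : ℝ),
      (((s ^ (β - 1) : ℝ) : ℂ) * Complex.exp (-(ε * s))) * (φ : 𝓢(ℝ, ℂ)) (x + σ * s)) (𝓝[>] 0)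
      (𝓝 (∫ s in Ioi (0 : ℝ), ((s ^ (β - 1) : ℝ) : ℂ) * (φ : 𝓢(ℝ, ℂ)) (x + σ * s))) := by
    refine tendsto_integral_filter_of_dominated_convergence _ ?_ ?_
      (integrableOn_rpow_mul_schwartz hβ φ x hσ).norm ?_
    · exact Eventually.of_forall fun ε => Measurable.aestronglyMeasurable (by fun_prop)
    · filter_upwards [self_mem_nhdsWithin] with ε hε
      filter_upwards [ae_restrict_mem measurableSet_Ioi] with s hs
      have h1 : ‖Complex.exp (-(ε * s))‖ ≤ 1 := by
        rw [Complex.norm_exp]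
        simpa using mul_nonneg (le_of_lt hε) (le_of_lt hs)
      rw [norm_mul, norm_mul, norm_mul]
      gcongr
      exact mul_le_of_le_one_right (norm_nonneg _) h1
    · refine Eventually.of_forall fun s => ?_
      have hc : Continuous fun ε : ℝ =>
          (((s ^ (β - 1) : ℝ) : ℂ) * Complex.exp (-(ε * s))) * (φ : 𝓢(ℝ, ℂ)) (x + σ * s) := by
        fun_prop
      have := (hc.tendsto 0).mono_left (nhdsWithin_le_nhds (s := Ioi 0))
      simpa using this
  have hright : Tendsto (fun ε : ℝ => ∫ ξ : ℝ, Complex.exp (2 * Real.pi * Complex.I * ξ * x) *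
        (Real.Gamma β * (ε - 2 * Real.pi * Complex.I * σ * ξ) ^ ((-β : ℝ) : ℂ) * ψ ξ)) (𝓝[>] 0)
      (𝓝 (∫ ξ : ℝ, Complex.exp (2 * Real.pi * Complex.I * ξ * x) *
        (Real.Gamma β * H ξ * ψ ξ))) := by
    have hzξ : ∀ ξ : ℝ, z * ξ = -(2 * Real.pi * Complex.I * σ * ξ) := fun ξ => by rw [hz]; ring
    refine tendsto_integral_filter_of_dominated_convergence
      (fun ξ => ‖Real.Gamma β‖ * ‖H ξ * ψ ξ‖) ?_ ?_
      ((integrable_homSymbol_mul _ _ _ (lizorkinFourier φ)).norm.const_mul _) ?_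
    · refine Eventually.of_forall fun ε => Measurable.aestronglyMeasurable ?_
      have : Measurable fun ξ : ℝ =>
          (ε - 2 * Real.pi * Complex.I * σ * ξ : ℂ) ^ ((-β : ℝ) : ℂ) :=
        Measurable.pow_const (by fun_prop) _
      fun_prop
    · filter_upwards [self_mem_nhdsWithin] with ε hε
      filter_upwards [Measure.ae_ne volume (0 : ℝ)] with ξ hξ0
      have h1 : ‖Complex.exp (2 * Real.pi * Complex.I * ξ * x)‖ = 1 := by
        rw [← Complex.norm_exp_ofReal_mul_I (2 * Real.pi * ξ * x)]
        congr 2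
        push_cast
        ring
      rw [norm_mul, h1, one_mul, norm_mul, norm_mul, Complex.norm_real, norm_mul, mul_assoc, hH,
        homSymbol_cpow hz0 _ hξ0, Complex.norm_cpow_real, Complex.norm_cpow_real, hzξ]
      gcongr ‖Real.Gamma β‖ * (?_ * ‖ψ ξ‖)
      refine Real.rpow_le_rpow_of_nonpos ?_ ?_ (by linarith)
      · simp [Real.pi_ne_zero, hσ, hξ0]
      · have h2 := Complex.abs_im_le_norm (ε - 2 * Real.pi * Complex.I * σ * ξ)
        have h3 : (ε - 2 * Real.pi * Complex.I * σ * ξ : ℂ).im = -(2 * Real.pi * σ * ξ) := by simp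
        have h4 : (2 * Real.pi * Complex.I * σ * ξ : ℂ) =
            ((2 * Real.pi * σ * ξ : ℝ) : ℂ) * Complex.I := by push_cast; ring
        rw [norm_neg, h4, norm_mul, Complex.norm_I, mul_one, Complex.norm_real, Real.norm_eq_abs,
          ← abs_neg, ← h3, ← h4]
        exact h2
    · filter_upwards [Measure.ae_ne volume (0 : ℝ)] with ξ hξ0
      refine Tendsto.const_mul _ (Tendsto.mul_const _ (Tendsto.const_mul _ ?_))
      rw [hH, homSymbol_cpow hz0 _ hξ0, hzξ]
      have hs : (-(2 * Real.pi * Complex.I * σ * ξ) : ℂ) ∈ Complex.slitPlane := by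
        right
        simp [Real.pi_ne_zero, hσ, hξ0]
      have hc : Tendsto (fun ε : ℝ => (ε - 2 * Real.pi * Complex.I * σ * ξ : ℂ)) (𝓝[>] 0)
          (𝓝 (-(2 * Real.pi * Complex.I * σ * ξ))) := by
        have hc' : Continuous fun ε : ℝ => (ε - 2 * Real.pi * Complex.I * σ * ξ : ℂ) := by
          fun_prop
        simpa using (hc'.tendsto 0).mono_left (nhdsWithin_le_nhds (s := Ioi 0))
      exact (continuousAt_cpow_const hs).tendsto.comp hc
  have heq := eventually_of_mem (self_mem_nhdsWithin (a := (0 : ℝ)) (s := Ioi 0)) fun ε hε =>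
    integral_rpow_mul_cexp_mul_lizorkin hβ φ x σ hε
  rw [tendsto_nhds_unique (hleft.congr' heq) hright, homMultiplier_apply, ← integral_const_mul]
  refine integral_congr_ae (Eventually.of_forall fun ξ => ?_)
  simp only
  ring

theorem leftKernel_sub (β : ℝ) (f : ℝ → ℂ) (x s : ℝ) :
    leftKernel β f x (x - s) = ((s ^ (β - 1) : ℝ) : ℂ) * f (x + (-1) * s) := by
  rw [leftKernel, sub_sub_cancel, neg_one_mul, ← sub_eq_add_neg]

theorem rightKernel_add (β : ℝ) (f : ℝ → ℂ) (x s : ℝ) :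
    rightKernel β f x (x + s) = ((s ^ (β - 1) : ℝ) : ℂ) * f (x + 1 * s) := by
  rw [rightKernel, add_sub_cancel_left, one_mul]

theorem integrableOn_leftKernel {β : ℝ} (hβ : 0 < β) (φ : 𝓢(ℝ, ℂ)) (x : ℝ) :
    IntegrableOn (leftKernel β φ x) (Iio x) := by
  rw [← (Measure.measurePreserving_sub_left volume x).integrableOn_comp_preimage
    (MeasurableEquiv.subLeft x).measurableEmbedding]
  simpa [Function.comp_def, leftKernel_sub] using
    integrableOn_rpow_mul_schwartz hβ φ x (σ := -1) (by norm_num)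

theorem integrableOn_rightKernel {β : ℝ} (hβ : 0 < β) (φ : 𝓢(ℝ, ℂ)) (x : ℝ) :
    IntegrableOn (rightKernel β φ x) (Ioi x) := by
  rw [← (measurePreserving_add_left volume x).integrableOn_comp_preimage
    (MeasurableEquiv.addLeft x).measurableEmbedding]
  simpa [Function.comp_def, rightKernel_add] using
    integrableOn_rpow_mul_schwartz hβ φ x (σ := 1) one_ne_zero

/-- The Fourier multiplier operator of `Φ` with symbol `(zξ)^s`. -/
def powMultiplier (z : ℂ) (s : ℝ) : lizorkin →ₗ[ℂ] lizorkin :=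
  homMultiplier (z ^ (s : ℂ)) ((-z) ^ (s : ℂ)) s

theorem leftFracInt_lizorkin {β : ℝ} (hβ : 0 < β) (φ : lizorkin) :
    leftFracInt β (φ : 𝓢(ℝ, ℂ)) =
      (powMultiplier (2 * Real.pi * Complex.I) (-β) φ : 𝓢(ℝ, ℂ)) := by
  ext x
  have h := integral_rpow_mul_lizorkin hβ φ x (σ := -1) (by norm_num)
    (z := 2 * Real.pi * Complex.I) (by simp)
  have h1 := (Measure.measurePreserving_sub_left volume x).setIntegral_preimage_emb
    (MeasurableEquiv.subLeft x).measurableEmbedding (leftKernel β (φ : 𝓢(ℝ, ℂ)) x) (Iio x)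
  simp only [leftKernel_sub, Set.preimage_const_sub_Iio, sub_self] at h1
  have hΓ : (Real.Gamma β : ℂ) ≠ 0 := by exact_mod_cast (Real.Gamma_pos_of_pos hβ).ne'
  rw [leftFracInt, if_neg hβ.ne', ← h1, h, powMultiplier]
  push_cast
  field_simp

theorem rightFracInt_lizorkin {β : ℝ} (hβ : 0 < β) (φ : lizorkin) :
    rightFracInt β (φ : 𝓢(ℝ, ℂ)) =
      (powMultiplier (-(2 * Real.pi * Complex.I)) (-β) φ : 𝓢(ℝ, ℂ)) := by
  ext x
  have h := integral_rpow_mul_lizorkin hβ φ x (σ := 1) one_ne_zero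
    (z := -(2 * Real.pi * Complex.I)) (by simp)
  have h1 := (measurePreserving_add_left volume x).setIntegral_preimage_emb
    (MeasurableEquiv.addLeft x).measurableEmbedding (rightKernel β (φ : 𝓢(ℝ, ℂ)) x) (Ioi x)
  simp only [rightKernel_add, Set.preimage_const_add_Ioi, sub_self] at h1
  have hΓ : (Real.Gamma β : ℂ) ≠ 0 := by exact_mod_cast (Real.Gamma_pos_of_pos hβ).ne'
  rw [rightFracInt, if_neg hβ.ne', ← h1, h, powMultiplier]
  push_cast
  field_simp

theorem pow_mul_cpow_neg_sub {z : ℂ} (hz : z ≠ 0) (n : ℕ) (α : ℝ) :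
    z ^ n * z ^ ((-(n - α) : ℝ) : ℂ) = z ^ (α : ℂ) := by
  rw [← Complex.cpow_natCast, ← Complex.cpow_add _ _ hz]
  congr 1
  push_cast
  ring

theorem leftFracDeriv_lizorkin {α : ℝ} (hα : α < ⌈α⌉₊) (φ : lizorkin) :
    leftFracDeriv α (φ : 𝓢(ℝ, ℂ)) =
      (powMultiplier (2 * Real.pi * Complex.I) α φ : 𝓢(ℝ, ℂ)) := by
  ext x
  have hz := Complex.two_pi_I_ne_zero
  rw [leftFracDeriv, leftFracInt_lizorkin (sub_pos.2 hα), iteratedDeriv_lizorkin, powMultiplier,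
    homMultiplier_homMultiplier, pow_mul_cpow_neg_sub hz, pow_mul_cpow_neg_sub (neg_ne_zero.2 hz),
    powMultiplier, show ((⌈α⌉₊ : ℝ) + -(⌈α⌉₊ - α)) = α by ring]

theorem rightFracDeriv_lizorkin {α : ℝ} (hα : α < ⌈α⌉₊) (φ : lizorkin) :
    rightFracDeriv α (φ : 𝓢(ℝ, ℂ)) =
      (powMultiplier (-(2 * Real.pi * Complex.I)) α φ : 𝓢(ℝ, ℂ)) := by
  ext x
  have hz := Complex.two_pi_I_ne_zero
  have hn : ∀ w : ℂ, (-1) ^ ⌈α⌉₊ * (w ^ ⌈α⌉₊ * (-w) ^ ((-(⌈α⌉₊ - α) : ℝ) : ℂ)) =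
      (-w) ^ ⌈α⌉₊ * (-w) ^ ((-(⌈α⌉₊ - α) : ℝ) : ℂ) := fun w => by
    rw [← mul_assoc, ← mul_pow, neg_one_mul]
  have h := homMultiplier_const_mul ((-1) ^ ⌈α⌉₊)
    ((2 * Real.pi * Complex.I) ^ ⌈α⌉₊ *
      (-(2 * Real.pi * Complex.I)) ^ ((-(⌈α⌉₊ - α) : ℝ) : ℂ))
    ((-(2 * Real.pi * Complex.I)) ^ ⌈α⌉₊ *
      (-(-(2 * Real.pi * Complex.I))) ^ ((-(⌈α⌉₊ - α) : ℝ) : ℂ)) (⌈α⌉₊ + -(⌈α⌉₊ - α)) φ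
  rw [hn, hn, pow_mul_cpow_neg_sub (neg_ne_zero.2 hz),
    pow_mul_cpow_neg_sub (neg_ne_zero.2 (neg_ne_zero.2 hz)),
    show ((⌈α⌉₊ : ℝ) + -(⌈α⌉₊ - α)) = α by ring] at h
  rw [rightFracDeriv, rightFracInt_lizorkin (sub_pos.2 hα), iteratedDeriv_lizorkin, powMultiplier,
    homMultiplier_homMultiplier, powMultiplier, h,
    show ((⌈α⌉₊ : ℝ) + -(⌈α⌉₊ - α)) = α by ring]
  rfl

/-! ### Integrals of the compensated exponential against `h^{-α-1}` -/

theorem norm_exp_le_one {w : ℂ} (hw : w.re ≤ 0) : ‖Complex.exp w‖ ≤ 1 := by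
  rw [Complex.norm_exp]
  exact Real.exp_le_one_iff.2 hw

theorem norm_exp_sub_one_le_two {w : ℂ} (hw : w.re ≤ 0) : ‖Complex.exp w - 1‖ ≤ 2 :=
  (norm_sub_le _ _).trans (by rw [norm_one]; linarith [norm_exp_le_one hw])

theorem norm_exp_sub_one_le_norm {w : ℂ} (hw : w.re ≤ 0) : ‖Complex.exp w - 1‖ ≤ ‖w‖ := by
  have h := Convex.norm_image_sub_le_of_norm_hasDerivWithin_le (f := Complex.exp)
    (f' := Complex.exp) (s := {w : ℂ | w.re ≤ 0}) (C := 1) (x := 0) (y := w)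
    (fun y _ => (Complex.hasDerivAt_exp y).hasDerivWithinAt)
    (fun y hy => norm_exp_le_one hy) (convex_halfSpace_re_le 0) (by simp) hw
  simpa using h

theorem norm_exp_sub_one_sub_le_sq {w : ℂ} (hw : w.re ≤ 0) :
    ‖Complex.exp w - 1 - w‖ ≤ ‖w‖ ^ 2 := by
  have h := Convex.norm_image_sub_le_of_norm_hasDerivWithin_le
    (f := fun w => Complex.exp w - 1 - w)
    (f' := fun w => Complex.exp w - 1) (s := {w : ℂ | w.re ≤ 0} ∩ Metric.closedBall 0 ‖w‖)
    (C := ‖w‖) (x := 0) (y := w)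
    (fun y _ => (((Complex.hasDerivAt_exp y).sub_const 1).sub (hasDerivAt_id y)).hasDerivWithinAt)
    (fun y hy => (norm_exp_sub_one_le_norm hy.1).trans (by simpa using hy.2))
    ((convex_halfSpace_re_le 0).inter (convex_closedBall _ _)) (by simp) ⟨hw, by simp⟩
  simpa [sq] using h

theorem norm_exp_sub_one_sub_le_two_mul {w : ℂ} (hw : w.re ≤ 0) :
    ‖Complex.exp w - 1 - w‖ ≤ 2 * ‖w‖ :=
  (norm_sub_le _ _).trans (by linarith [norm_exp_sub_one_le_norm hw])

theorem integrableOn_Ioi_of_le_rpow {f : ℝ → ℂ} {C D p q : ℝ} (hf : Measurable f) (hp : -1 < p)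
    (hq : q < -1) (h0 : ∀ h, 0 < h → h ≤ 1 → ‖f h‖ ≤ C * h ^ p)
    (h1 : ∀ h, 1 < h → ‖f h‖ ≤ D * h ^ q) : IntegrableOn f (Ioi 0) := by
  rw [← Ioc_union_Ioi_eq_Ioi zero_le_one]
  refine IntegrableOn.union ?_ ?_
  · have hi : IntegrableOn (fun h : ℝ => C * h ^ p) (Ioc 0 1) :=
      ((intervalIntegrable_iff_integrableOn_Ioc_of_le zero_le_one).1
        (intervalIntegral.intervalIntegrable_rpow' hp)).const_mul C
    refine Integrable.mono' hi hf.aestronglyMeasurable ?_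
    filter_upwards [ae_restrict_mem measurableSet_Ioc] with h hh using h0 h hh.1 hh.2
  · have hi : IntegrableOn (fun h : ℝ => D * h ^ q) (Ioi 1) :=
      (integrableOn_Ioi_rpow_of_lt hq one_pos).const_mul D
    refine Integrable.mono' hi hf.aestronglyMeasurable ?_
    filter_upwards [ae_restrict_mem measurableSet_Ioi] with h hh using h1 h hh

theorem re_neg_mul_ofReal_nonpos {z : ℂ} (hz : 0 ≤ z.re) {h : ℝ} (hh : 0 ≤ h) :
    (-(z * h)).re ≤ 0 := by
  simpa using mul_nonneg hz hh

theorem norm_mul_rpow_ofReal (w : ℂ) {h : ℝ} (hh : 0 ≤ h) (s : ℝ) :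
    ‖w * ((h ^ s : ℝ) : ℂ)‖ = ‖w‖ * h ^ s := by
  rw [norm_mul, Complex.norm_real, Real.norm_of_nonneg (Real.rpow_nonneg hh s)]

theorem integrableOn_exp_sub_one {α : ℝ} (h0 : 0 < α) (h1 : α < 1) {z : ℂ} (hz : 0 ≤ z.re) :
    IntegrableOn (fun h : ℝ => (Complex.exp (-(z * h)) - 1) * ((h ^ (-α - 1) : ℝ) : ℂ))
      (Ioi 0) := by
  refine integrableOn_Ioi_of_le_rpow (C := ‖z‖) (D := 2) (p := -α) (q := -α - 1) (by fun_prop)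
    (by linarith) (by linarith) (fun h hh _ => ?_) (fun h hh => ?_)
  · rw [norm_mul_rpow_ofReal _ hh.le]
    have h2 := norm_exp_sub_one_le_norm (re_neg_mul_ofReal_nonpos hz hh.le)
    rw [norm_neg, norm_mul, Complex.norm_real, Real.norm_of_nonneg hh.le] at h2
    calc _ ≤ ‖z‖ * h * h ^ (-α - 1) := by gcongr
      _ = ‖z‖ * h ^ (-α) := by rw [Real.rpow_sub_one hh.ne']; field_simp
  · have hh' : 0 ≤ h := zero_le_one.trans hh.le
    rw [norm_mul_rpow_ofReal _ hh']
    gcongr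
    exact norm_exp_sub_one_le_two (re_neg_mul_ofReal_nonpos hz hh')

theorem integrableOn_exp_sub_one_sub {α : ℝ} (h0 : 1 < α) (h1 : α < 2) {z : ℂ} (hz : 0 ≤ z.re) :
    IntegrableOn (fun h : ℝ => (Complex.exp (-(z * h)) - 1 - -(z * h)) *
      ((h ^ (-α - 1) : ℝ) : ℂ)) (Ioi 0) := by
  refine integrableOn_Ioi_of_le_rpow (C := ‖z‖ ^ 2) (D := 2 * ‖z‖) (p := 1 - α) (q := -α)
    (by fun_prop) (by linarith) (by linarith) (fun h hh _ => ?_) (fun h hh => ?_)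
  · rw [norm_mul_rpow_ofReal _ hh.le]
    have h2 := norm_exp_sub_one_sub_le_sq (re_neg_mul_ofReal_nonpos hz hh.le)
    rw [norm_neg, norm_mul, Complex.norm_real, Real.norm_of_nonneg hh.le] at h2
    calc _ ≤ (‖z‖ * h) ^ 2 * h ^ (-α - 1) := by gcongr
      _ = ‖z‖ ^ 2 * h ^ (1 - α) := by
        rw [mul_pow, mul_assoc, ← Real.rpow_natCast h 2, ← Real.rpow_add hh]
        congr 2
        push_cast
        ring
  · have hh' : 0 < h := zero_lt_one.trans hh
    rw [norm_mul_rpow_ofReal _ hh'.le]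
    have h2 := norm_exp_sub_one_sub_le_two_mul (re_neg_mul_ofReal_nonpos hz hh'.le)
    rw [norm_neg, norm_mul, Complex.norm_real, Real.norm_of_nonneg hh'.le] at h2
    calc _ ≤ 2 * (‖z‖ * h) * h ^ (-α - 1) := by gcongr
      _ = 2 * ‖z‖ * h ^ (-α) := by rw [Real.rpow_sub_one hh'.ne']; field_simp

theorem hasDerivAt_neg_rpow_div {α : ℝ} (hα : α ≠ 0) {h : ℝ} (hh : 0 < h) :
    HasDerivAt (fun h : ℝ => ((-h ^ (-α) / α : ℝ) : ℂ)) ((h ^ (-α - 1) : ℝ) : ℂ) h := by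
  have h1 := ((Real.hasDerivAt_rpow_const (x := h) (p := -α) (Or.inl hh.ne')).neg.div_const
    α).ofReal_comp
  refine h1.congr_deriv ?_
  congr 1
  field_simp

theorem hasDerivAt_cexp_neg_mul (z : ℂ) (h : ℝ) :
    HasDerivAt (fun h : ℝ => Complex.exp (-(z * h))) (-(z * Complex.exp (-(z * h)))) h := by
  have h1 : HasDerivAt (fun h : ℝ => -(z * (h : ℂ))) (-(z * ((1 : ℝ) : ℂ))) h :=
    ((hasDerivAt_id h).ofReal_comp.const_mul z).neg
  refine h1.cexp.congr_deriv ?_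
  push_cast
  ring

/-- If `‖f h‖ ≤ C h^p` with `p > α` near the origin, the boundary term of the partial integration
against `h^{-α-1}` vanishes there; likewise at infinity for `p < α`. -/
theorem tendsto_mul_neg_rpow_div {f : ℝ → ℂ} {C p α : ℝ} {l : Filter ℝ}
    (hl : ∀ᶠ h in l, 0 < h ∧ ‖f h‖ ≤ C * h ^ p)
    (ht : Tendsto (fun h : ℝ => h ^ (p - α)) l (𝓝 0)) :
    Tendsto (f * fun h : ℝ => ((-h ^ (-α) / α : ℝ) : ℂ)) l (𝓝 0) := by
  refine squeeze_zero_norm' (a := fun h => C / |α| * h ^ (p - α)) ?_ ?_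
  · filter_upwards [hl] with h hh
    rw [Pi.mul_apply, norm_mul, Complex.norm_real, norm_div, norm_neg, Real.norm_eq_abs α,
      Real.norm_of_nonneg (Real.rpow_nonneg hh.1.le _), sub_eq_add_neg, Real.rpow_add hh.1]
    have := Real.rpow_nonneg hh.1.le (-α)
    calc _ ≤ C * h ^ p * (h ^ (-α) / |α|) := by gcongr; exact hh.2
      _ = _ := by ring
  · simpa using ht.const_mul (C / |α|)

theorem tendsto_rpow_nhdsGT_zero {p : ℝ} (hp : 0 < p) :
    Tendsto (fun h : ℝ => h ^ p) (𝓝[>] 0) (𝓝 0) := by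
  have := (Real.continuousAt_rpow_const 0 p (Or.inr hp.le)).tendsto
  rw [Real.zero_rpow hp.ne'] at this
  exact this.mono_left nhdsWithin_le_nhds

theorem tendsto_rpow_atTop_zero_of_neg {p : ℝ} (hp : p < 0) :
    Tendsto (fun h : ℝ => h ^ p) atTop (𝓝 0) := by
  simpa using tendsto_rpow_neg_atTop (neg_pos.2 hp)

theorem Gamma_one_sub {α : ℝ} (hα : α ≠ 0) : Real.Gamma (1 - α) = -α * Real.Gamma (-α) := by
  rw [← Real.Gamma_add_one (neg_ne_zero.2 hα)]
  ring_nf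

theorem integral_exp_sub_one_of_re_pos {α : ℝ} (h0 : 0 < α) (h1 : α < 1) {z : ℂ} (hz : 0 < z.re) :
    ∫ h in Ioi (0 : ℝ), (Complex.exp (-(z * h)) - 1) * ((h ^ (-α - 1) : ℝ) : ℂ) =
      Real.Gamma (-α) * z ^ (α : ℂ) := by
  have hz0 : z ≠ 0 := fun h => by simp [h] at hz
  have hαC : (α : ℂ) ≠ 0 := by exact_mod_cast h0.ne'
  have hbase := integral_rpow_mul_cexp (β := 1 - α) (by linarith) hz
  have hfun : ((fun h : ℝ => -(z * Complex.exp (-(z * h)))) *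
      fun h : ℝ => ((-h ^ (-α) / α : ℝ) : ℂ)) = fun h : ℝ =>
      z / α * (((h ^ (1 - α - 1) : ℝ) : ℂ) * Complex.exp (-(z * h))) := by
    ext h
    rw [Pi.mul_apply, show 1 - α - 1 = -α by ring]
    push_cast
    ring
  have hint := (integrableOn_rpow_mul_cexp (s := 1 - α - 1) (by linarith) hz).const_mul (z / α)
  have h := integral_Ioi_mul_deriv_eq_deriv_mul (a := (0 : ℝ)) (a' := (0 : ℂ)) (b' := (0 : ℂ))
    (u := fun h : ℝ => Complex.exp (-(z * h)) - 1)
    (u' := fun h : ℝ => -(z * Complex.exp (-(z * h))))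
    (v := fun h : ℝ => ((-h ^ (-α) / α : ℝ) : ℂ)) (v' := fun h : ℝ => ((h ^ (-α - 1) : ℝ) : ℂ))
    (fun h _ => (hasDerivAt_cexp_neg_mul z h).sub_const 1)
    (fun h hh => hasDerivAt_neg_rpow_div h0.ne' hh) (integrableOn_exp_sub_one h0 h1 hz.le)
    (by rw [hfun]; exact hint)
    (tendsto_mul_neg_rpow_div (C := ‖z‖) (p := 1) ?_ (tendsto_rpow_nhdsGT_zero (by linarith)))
    (tendsto_mul_neg_rpow_div (C := 2) (p := 0) ?_ (tendsto_rpow_atTop_zero_of_neg (by linarith)))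
  · rw [h]
    have h2 : ∫ h in Ioi (0 : ℝ), -(z * Complex.exp (-(z * h))) * ((-h ^ (-α) / α : ℝ) : ℂ) =
        z / α * (Real.Gamma (1 - α) * z ^ ((-(1 - α) : ℝ) : ℂ)) := by
      rw [← hbase, ← integral_const_mul]
      exact integral_congr_ae (Eventually.of_forall fun h => congrFun hfun h)
    rw [h2, Gamma_one_sub h0.ne', show ((-(1 - α) : ℝ) : ℂ) = (α : ℂ) - 1 by push_cast; ring,
      Complex.cpow_sub _ _ hz0, Complex.cpow_one]
    push_cast
    field_simp
    ring
  · filter_upwards [self_mem_nhdsWithin] with h hh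
    refine ⟨hh, (norm_exp_sub_one_le_norm (re_neg_mul_ofReal_nonpos hz.le (le_of_lt hh))).trans ?_⟩
    rw [norm_neg, norm_mul, Complex.norm_real, Real.norm_of_nonneg (le_of_lt hh), Real.rpow_one]
  · filter_upwards [eventually_gt_atTop 0] with h hh
    refine ⟨hh, (norm_exp_sub_one_le_two (re_neg_mul_ofReal_nonpos hz.le hh.le)).trans ?_⟩
    rw [Real.rpow_zero, mul_one]

theorem mem_slitPlane_of_re_nonneg {z : ℂ} (hz : 0 ≤ z.re) (hz0 : z ≠ 0) :
    z ∈ Complex.slitPlane := by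
  rcases hz.lt_or_eq with h | h
  · exact Or.inl h
  · exact Or.inr fun h' => hz0 (Complex.ext h.symm h')

/-- The boundary case `z.re = 0` follows from `z.re > 0` by dominated convergence. -/
theorem integral_exp_sub_one {α : ℝ} (h0 : 0 < α) (h1 : α < 1) {z : ℂ} (hz : 0 ≤ z.re)
    (hz0 : z ≠ 0) :
    ∫ h in Ioi (0 : ℝ), (Complex.exp (-(z * h)) - 1) * ((h ^ (-α - 1) : ℝ) : ℂ) =
      Real.Gamma (-α) * z ^ (α : ℂ) := by
  have hcont : Continuous fun ε : ℝ => (ε : ℂ) + z := by fun_prop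
  have hε : Tendsto (fun ε : ℝ => (ε : ℂ) + z) (𝓝[>] 0) (𝓝 z) := by
    simpa using (hcont.tendsto 0).mono_left (nhdsWithin_le_nhds (s := Ioi 0))
  have hright : Tendsto (fun ε : ℝ => (Real.Gamma (-α) : ℂ) * ((ε : ℂ) + z) ^ (α : ℂ)) (𝓝[>] 0)
      (𝓝 (Real.Gamma (-α) * z ^ (α : ℂ))) :=
    ((continuousAt_cpow_const (mem_slitPlane_of_re_nonneg hz hz0)).tendsto.comp hε).const_mul _
  refine tendsto_nhds_unique ?_ hright
  have heq := eventually_of_mem (self_mem_nhdsWithin (a := (0 : ℝ)) (s := Ioi 0)) fun ε hε' =>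
    integral_exp_sub_one_of_re_pos h0 h1 (z := ε + z)
      (by simpa using add_pos_of_pos_of_nonneg hε' hz)
  refine Tendsto.congr' heq ?_
  have hdom : IntegrableOn (fun h : ℝ =>
      min 2 ((1 + ‖z‖) * h) * h ^ (-α - 1)) (Ioi 0) := by
    have := integrableOn_Ioi_of_le_rpow (C := 1 + ‖z‖) (D := 2) (p := -α) (q := -α - 1)
      (f := fun h : ℝ => ((min 2 ((1 + ‖z‖) * h) * h ^ (-α - 1) : ℝ) : ℂ)) (by fun_prop)
      (by linarith) (by linarith) (fun h hh _ => ?_) (fun h hh => ?_)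
    · exact this.re
    · have hm : 0 ≤ min 2 ((1 + ‖z‖) * h) := by positivity
      rw [Complex.norm_real, Real.norm_of_nonneg (by positivity)]
      calc _ ≤ (1 + ‖z‖) * h * h ^ (-α - 1) := by gcongr; exact min_le_right _ _
        _ = _ := by rw [Real.rpow_sub_one hh.ne']; field_simp
    · have hh' : 0 < h := zero_lt_one.trans hh
      have hm : 0 ≤ min 2 ((1 + ‖z‖) * h) := by positivity
      rw [Complex.norm_real, Real.norm_of_nonneg (by positivity)]
      gcongr
      exact min_le_left _ _
  refine tendsto_integral_filter_of_dominated_convergence _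
    (Eventually.of_forall fun ε => Measurable.aestronglyMeasurable (by fun_prop)) ?_ hdom ?_
  · filter_upwards [self_mem_nhdsWithin, nhdsWithin_le_nhds (gt_mem_nhds one_pos)] with ε hε0 hε1
    filter_upwards [ae_restrict_mem measurableSet_Ioi] with h hh
    have hh' : 0 < h := hh
    have hre : 0 ≤ ((ε : ℂ) + z).re := by
      simpa using (add_pos_of_pos_of_nonneg hε0 hz).le
    rw [norm_mul_rpow_ofReal _ hh'.le]
    gcongr
    refine le_min (norm_exp_sub_one_le_two (re_neg_mul_ofReal_nonpos hre hh'.le))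
      ((norm_exp_sub_one_le_norm (re_neg_mul_ofReal_nonpos hre hh'.le)).trans ?_)
    rw [norm_neg, norm_mul, Complex.norm_real, Real.norm_of_nonneg hh'.le]
    gcongr
    refine (norm_add_le _ _).trans ?_
    rw [Complex.norm_real, Real.norm_of_nonneg (le_of_lt hε0)]
    gcongr
  · refine Eventually.of_forall fun h => ?_
    have hc : Continuous fun w : ℂ =>
        (Complex.exp (-(w * h)) - 1) * ((h ^ (-α - 1) : ℝ) : ℂ) := by fun_prop
    exact (hc.tendsto z).comp hε

theorem integral_exp_sub_one_sub {α : ℝ} (h0 : 1 < α) (h1 : α < 2) {z : ℂ} (hz : 0 ≤ z.re)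
    (hz0 : z ≠ 0) :
    ∫ h in Ioi (0 : ℝ), (Complex.exp (-(z * h)) - 1 - -(z * h)) * ((h ^ (-α - 1) : ℝ) : ℂ) =
      Real.Gamma (-α) * z ^ (α : ℂ) := by
  have hα : α ≠ 0 := by linarith
  have hαC : (α : ℂ) ≠ 0 := by exact_mod_cast hα
  have hbase := integral_exp_sub_one (α := α - 1) (by linarith) (by linarith) hz hz0
  have hfun : ((fun h : ℝ => -(z * (Complex.exp (-(z * h)) - 1))) *
      fun h : ℝ => ((-h ^ (-α) / α : ℝ) : ℂ)) = fun h : ℝ =>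
      z / α * ((Complex.exp (-(z * h)) - 1) * ((h ^ (-(α - 1) - 1) : ℝ) : ℂ)) := by
    ext h
    rw [Pi.mul_apply, show -(α - 1) - 1 = -α by ring]
    push_cast
    ring
  have hint := (integrableOn_exp_sub_one (α := α - 1) (by linarith) (by linarith) hz).const_mul
    (z / α)
  have h := integral_Ioi_mul_deriv_eq_deriv_mul (a := (0 : ℝ)) (a' := (0 : ℂ)) (b' := (0 : ℂ))
    (u := fun h : ℝ => Complex.exp (-(z * h)) - 1 - -(z * h))
    (u' := fun h : ℝ => -(z * (Complex.exp (-(z * h)) - 1)))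
    (v := fun h : ℝ => ((-h ^ (-α) / α : ℝ) : ℂ)) (v' := fun h : ℝ => ((h ^ (-α - 1) : ℝ) : ℂ))
    (fun h _ => (((hasDerivAt_cexp_neg_mul z h).sub_const 1).sub
      (((hasDerivAt_id h).ofReal_comp.const_mul z).neg)).congr_deriv (by push_cast; ring))
    (fun h hh => hasDerivAt_neg_rpow_div hα hh) (integrableOn_exp_sub_one_sub h0 h1 hz)
    (by rw [hfun]; exact hint)
    (tendsto_mul_neg_rpow_div (C := ‖z‖ ^ 2) (p := 2) ?_ (tendsto_rpow_nhdsGT_zero (by linarith)))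
    (tendsto_mul_neg_rpow_div (C := 2 * ‖z‖) (p := 1) ?_
      (tendsto_rpow_atTop_zero_of_neg (by linarith)))
  · rw [h]
    have h2 : ∫ h in Ioi (0 : ℝ), -(z * (Complex.exp (-(z * h)) - 1)) *
        ((-h ^ (-α) / α : ℝ) : ℂ) =
        z / α * (Real.Gamma (-(α - 1)) * z ^ ((α - 1 : ℝ) : ℂ)) := by
      rw [← hbase, ← integral_const_mul]
      exact integral_congr_ae (Eventually.of_forall fun h => congrFun hfun h)
    rw [h2, neg_sub, Gamma_one_sub hα, Complex.ofReal_sub, Complex.ofReal_one,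
      Complex.cpow_sub _ _ hz0, Complex.cpow_one]
    push_cast
    field_simp
    ring
  · filter_upwards [self_mem_nhdsWithin] with h hh
    refine ⟨hh, (norm_exp_sub_one_sub_le_sq
      (re_neg_mul_ofReal_nonpos hz (le_of_lt hh))).trans ?_⟩
    rw [norm_neg, norm_mul, Complex.norm_real, Real.norm_of_nonneg (le_of_lt hh), mul_pow,
      Real.rpow_two]
  · filter_upwards [eventually_gt_atTop 0] with h hh
    refine ⟨hh, (norm_exp_sub_one_sub_le_two_mul (re_neg_mul_ofReal_nonpos hz hh.le)).trans ?_⟩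
    rw [norm_neg, norm_mul, Complex.norm_real, Real.norm_of_nonneg hh.le, Real.rpow_one, mul_assoc]

/-! ### The characteristic exponent of a strictly stable process -/

theorem measurable_stableLevyMeasure_density (α cneg cpos : ℝ) :
    Measurable fun h : ℝ => ENNReal.ofReal
      (((if h < 0 then cneg else 0) + (if 0 < h then cpos else 0)) / |h| ^ (α + 1)) := by
  refine Measurable.ennreal_ofReal (Measurable.div (Measurable.add ?_ ?_) ?_)
  · exact Measurable.ite measurableSet_Iio measurable_const measurable_const
  · exact Measurable.ite measurableSet_Ioi measurable_const measurable_const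
  · exact (measurable_id.abs).pow_const _

theorem stableLevyMeasure_integral {α cneg cpos : ℝ} (hneg : 0 ≤ cneg) (hpos : 0 ≤ cpos)
    {f : ℝ → ℂ} (hf1 : IntegrableOn (fun h => f h * ((h ^ (-α - 1) : ℝ) : ℂ)) (Ioi 0))
    (hf2 : IntegrableOn (fun h => f (-h) * ((h ^ (-α - 1) : ℝ) : ℂ)) (Ioi 0)) :
    Integrable f (stableLevyMeasure α cneg cpos) ∧
      ∫ h, f h ∂stableLevyMeasure α cneg cpos =
        cneg * (∫ h in Ioi (0 : ℝ), f (-h) * ((h ^ (-α - 1) : ℝ) : ℂ)) +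
        cpos * ∫ h in Ioi (0 : ℝ), f h * ((h ^ (-α - 1) : ℝ) : ℂ) := by
  set d : ℝ → ENNReal := fun h => ENNReal.ofReal
    (((if h < 0 then cneg else 0) + (if 0 < h then cpos else 0)) / |h| ^ (α + 1)) with hd
  have hdm : Measurable d := measurable_stableLevyMeasure_density α cneg cpos
  have hlt : ∀ᵐ h : ℝ, d h < ⊤ := Eventually.of_forall fun h => ENNReal.ofReal_lt_top
  have hdpos : ∀ h ∈ Ioi (0 : ℝ),
      (d h).toReal • f h = cpos * (f h * ((h ^ (-α - 1) : ℝ) : ℂ)) := fun h hh => by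
    have hh' : 0 < h := hh
    have h1 : d h = ENNReal.ofReal (cpos * h ^ (-α - 1)) := by
      simp only [hd, if_neg hh'.not_gt, if_pos hh', zero_add, abs_of_pos hh']
      rw [show -α - 1 = -(α + 1) by ring, Real.rpow_neg hh'.le, div_eq_mul_inv]
    rw [h1, ENNReal.toReal_ofReal (by positivity), Complex.real_smul]
    push_cast
    ring
  have hdneg : ∀ h ∈ Ioi (0 : ℝ),
      (d (-h)).toReal • f (-h) = cneg * (f (-h) * ((h ^ (-α - 1) : ℝ) : ℂ)) := fun h hh => by
    have hh' : 0 < h := hh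
    have h1 : d (-h) = ENNReal.ofReal (cneg * h ^ (-α - 1)) := by
      simp only [hd, if_neg (neg_neg_of_pos hh').not_gt, if_pos (neg_neg_of_pos hh'), add_zero,
        abs_neg, abs_of_pos hh']
      rw [show -α - 1 = -(α + 1) by ring, Real.rpow_neg hh'.le, div_eq_mul_inv]
    rw [h1, ENNReal.toReal_ofReal (by positivity), Complex.real_smul]
    push_cast
    ring
  have hI1 : IntegrableOn (fun h => (d h).toReal • f h) (Ioi 0) :=
    (integrableOn_congr_fun hdpos measurableSet_Ioi).2 (hf1.const_mul _)
  have hI2 : IntegrableOn (fun h => (d h).toReal • f h) (Iic 0) := by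
    have h2 : IntegrableOn (fun h => (d (-h)).toReal • f (-h)) (Ioi 0) :=
      (integrableOn_congr_fun hdneg measurableSet_Ioi).2 (hf2.const_mul _)
    rw [integrableOn_Iic_iff_integrableOn_Iio,
      ← (Measure.measurePreserving_neg volume).integrableOn_comp_preimage
        (MeasurableEquiv.neg ℝ).measurableEmbedding]
    simpa [Function.comp_def] using h2
  have hI : Integrable (fun h => (d h).toReal • f h) := by
    rw [← integrableOn_univ, ← Iic_union_Ioi (a := (0 : ℝ))]
    exact hI2.union hI1
  refine ⟨(integrable_withDensity_iff_integrable_smul' hdm hlt).2 hI, ?_⟩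
  rw [stableLevyMeasure, integral_withDensity_eq_integral_toReal_smul hdm hlt,
    ← integral_add_compl measurableSet_Iic hI, compl_Iic,
    setIntegral_congr_fun measurableSet_Ioi hdpos, integral_const_mul]
  congr 1
  have h3 := integral_comp_neg_Ioi 0 (fun h => (d h).toReal • f h)
  rw [neg_zero] at h3
  rw [← h3, setIntegral_congr_fun measurableSet_Ioi hdneg, integral_const_mul]

/-- The characteristic exponent of a strictly stable process: `M₋ (iu)^α + M₊ (-iu)^α`. -/
def stableExponent (α cneg cpos u : ℝ) : ℂ :=
  stableM α cneg * (Complex.I * u) ^ (α : ℂ) + stableM α cpos * (-(Complex.I * u)) ^ (α : ℂ)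

theorem stableExponent_zero {α : ℝ} (hα : α ≠ 0) (cneg cpos : ℝ) :
    stableExponent α cneg cpos 0 = 0 := by
  simp [stableExponent, hα]

theorem stableExponent_mul (α cneg cpos : ℝ) {r u : ℝ} (hr : 0 < r) (hu : u ≠ 0) :
    stableExponent α cneg cpos (r * u) = ((r ^ α : ℝ) : ℂ) * stableExponent α cneg cpos u := by
  have hz : Complex.I * u ≠ 0 := by simp [hu]
  rw [stableExponent, show Complex.I * ((r * u : ℝ) : ℂ) = Complex.I * u * r by push_cast; ring,
    ← neg_mul, ofReal_mul_cpow hr hz, ofReal_mul_cpow hr (neg_ne_zero.2 hz), stableExponent]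
  ring

theorem levyKhintchineExponent_zero (a b : ℝ) (ν : Measure ℝ) :
    levyKhintchineExponent a b ν 0 = 0 := by
  simp [levyKhintchineExponent]

theorem stableLevyMeasure_integral_exp_sub_one {α cneg cpos : ℝ} (h0 : 0 < α) (h1 : α < 1)
    (hneg : 0 ≤ cneg) (hpos : 0 ≤ cpos) {u : ℝ} (hu : u ≠ 0) :
    Integrable (fun h : ℝ => Complex.exp (Complex.I * u * h) - 1)
      (stableLevyMeasure α cneg cpos) ∧
      ∫ h : ℝ, (Complex.exp (Complex.I * u * h) - 1) ∂stableLevyMeasure α cneg cpos =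
        stableExponent α cneg cpos u := by
  have hz : Complex.I * u ≠ 0 := by simp [hu]
  have e1 : ∀ h : ℝ, Complex.exp (Complex.I * u * ((-h : ℝ) : ℂ)) =
      Complex.exp (-(Complex.I * u * h)) := fun h => by
    congr 1
    push_cast
    ring
  have e2 : ∀ h : ℝ, Complex.exp (Complex.I * u * h) =
      Complex.exp (-(-(Complex.I * u) * h)) := fun h => by
    congr 1
    ring
  obtain ⟨hi, he⟩ := stableLevyMeasure_integral hneg hpos
    (f := fun h : ℝ => Complex.exp (Complex.I * u * h) - 1) (α := α)
    (by simp only [e2]; exact integrableOn_exp_sub_one h0 h1 (by simp))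
    (by simp only [e1]; exact integrableOn_exp_sub_one h0 h1 (by simp))
  refine ⟨hi, he.trans ?_⟩
  simp only [e1]
  simp only [e2]
  rw [integral_exp_sub_one h0 h1 (by simp) hz,
    integral_exp_sub_one h0 h1 (by simp) (neg_ne_zero.2 hz), stableExponent, stableM, stableM]
  push_cast
  ring

theorem stableLevyMeasure_integral_exp_sub_one_sub {α cneg cpos : ℝ} (h0 : 1 < α) (h1 : α < 2)
    (hneg : 0 ≤ cneg) (hpos : 0 ≤ cpos) {u : ℝ} (hu : u ≠ 0) :
    Integrable (fun h : ℝ => Complex.exp (Complex.I * u * h) - 1 - Complex.I * u * h)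
      (stableLevyMeasure α cneg cpos) ∧
      ∫ h : ℝ, (Complex.exp (Complex.I * u * h) - 1 - Complex.I * u * h)
        ∂stableLevyMeasure α cneg cpos = stableExponent α cneg cpos u := by
  have hz : Complex.I * u ≠ 0 := by simp [hu]
  have e1 : ∀ h : ℝ, Complex.I * u * ((-h : ℝ) : ℂ) = -(Complex.I * u * h) := fun h => by
    push_cast
    ring
  have e2 : ∀ h : ℝ, Complex.I * u * h = -(-(Complex.I * u) * h) := fun h => by ring
  have f1 : (fun h : ℝ => (Complex.exp (Complex.I * u * ((-h : ℝ) : ℂ)) - 1 -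
      Complex.I * u * ((-h : ℝ) : ℂ)) * ((h ^ (-α - 1) : ℝ) : ℂ)) = fun h : ℝ =>
      (Complex.exp (-(Complex.I * u * h)) - 1 - -(Complex.I * u * h)) *
        ((h ^ (-α - 1) : ℝ) : ℂ) := by
    ext h
    rw [e1]
  have f2 : (fun h : ℝ => (Complex.exp (Complex.I * u * h) - 1 -
      Complex.I * u * h) * ((h ^ (-α - 1) : ℝ) : ℂ)) = fun h : ℝ =>
      (Complex.exp (-(-(Complex.I * u) * h)) - 1 - -(-(Complex.I * u) * h)) *
        ((h ^ (-α - 1) : ℝ) : ℂ) := by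
    ext h
    rw [← e2]
  obtain ⟨hi, he⟩ := stableLevyMeasure_integral hneg hpos
    (f := fun h : ℝ => Complex.exp (Complex.I * u * h) - 1 - Complex.I * u * h) (α := α)
    (by rw [f2]; exact integrableOn_exp_sub_one_sub h0 h1 (by simp))
    (by rw [f1]; exact integrableOn_exp_sub_one_sub h0 h1 (by simp))
  refine ⟨hi, he.trans ?_⟩
  rw [f1, f2, integral_exp_sub_one_sub h0 h1 (by simp) hz,
    integral_exp_sub_one_sub h0 h1 (by simp) (neg_ne_zero.2 hz), stableExponent, stableM, stableM]
  push_cast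
  ring

/-- Compensating all jumps or none, according to whether `α > 1` or `α < 1`, instead of those of
size at most one changes the exponent by a linear term only. -/
theorem exists_levyKhintchineExponent_eq {α cneg cpos : ℝ} (hα : α ∈ Ioo (0 : ℝ) 2) (hα1 : α ≠ 1)
    (hneg : 0 ≤ cneg) (hpos : 0 ≤ cpos) (a b : ℝ) :
    ∃ B : ℂ, ∀ u : ℝ, levyKhintchineExponent a b (stableLevyMeasure α cneg cpos) u =
      B * u - a * u ^ 2 / 2 + stableExponent α cneg cpos u := by
  rcases hα1.lt_or_gt with h1 | h1
  · set k : ℝ → ℂ := fun h => if |h| ≤ 1 then Complex.I * h else 0 with hk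
    have hkm : Measurable k := Measurable.ite (measurableSet_le measurable_id.abs measurable_const)
      (by fun_prop) measurable_const
    have hkb : ∀ h, ‖k h‖ ≤ |h| := fun h => by
      by_cases hh : |h| ≤ 1 <;> simp [hk, hh]
    have hk0 : ∀ h, 1 < |h| → k h = 0 := fun h hh => by simp [hk, hh]
    have hint : ∀ s : ℝ, |s| = 1 →
        IntegrableOn (fun h => k (s * h) * ((h ^ (-α - 1) : ℝ) : ℂ)) (Ioi 0) := fun s hs => by
      refine integrableOn_Ioi_of_le_rpow (C := 1) (D := 0) (p := -α) (q := -2) (by fun_prop)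
        (by linarith) (by norm_num) (fun h hh _ => ?_) (fun h hh => ?_)
      · rw [norm_mul_rpow_ofReal _ hh.le]
        have h2 := hkb (s * h)
        rw [abs_mul, hs, one_mul, abs_of_pos hh] at h2
        calc _ ≤ h * h ^ (-α - 1) := by gcongr
          _ = 1 * h ^ (-α) := by rw [Real.rpow_sub_one hh.ne']; field_simp
      · rw [hk0 _ (by rw [abs_mul, hs, one_mul]; exact hh.trans_le (le_abs_self h))]
        simp
    have hki := (stableLevyMeasure_integral hneg hpos (f := k) (α := α)
      (by simpa using hint 1 (by simp)) (by simpa using hint (-1) (by simp))).1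
    refine ⟨Complex.I * b - ∫ h, k h ∂stableLevyMeasure α cneg cpos, fun u => ?_⟩
    rcases eq_or_ne u 0 with rfl | hu
    · simp [levyKhintchineExponent_zero, stableExponent_zero hα.1.ne']
    obtain ⟨hi, he⟩ := stableLevyMeasure_integral_exp_sub_one hα.1 h1 hneg hpos hu
    have hsplit : ∫ h : ℝ, (Complex.exp (Complex.I * u * h) - 1 -
        (if |h| ≤ 1 then Complex.I * u * h else 0)) ∂stableLevyMeasure α cneg cpos =
        stableExponent α cneg cpos u - u * ∫ h, k h ∂stableLevyMeasure α cneg cpos := by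
      rw [← he, ← integral_const_mul, ← integral_sub hi (hki.const_mul _)]
      refine integral_congr_ae (Eventually.of_forall fun h => ?_)
      by_cases hh : |h| ≤ 1
      · simp only [hk, if_pos hh]; ring
      · simp only [hk, if_neg hh]; ring
    rw [levyKhintchineExponent, hsplit]
    ring
  · set k : ℝ → ℂ := fun h => if |h| ≤ 1 then 0 else Complex.I * h with hk
    have hkm : Measurable k := Measurable.ite (measurableSet_le measurable_id.abs measurable_const)
      measurable_const (by fun_prop)
    have hkb : ∀ h, ‖k h‖ ≤ |h| := fun h => by
      by_cases hh : |h| ≤ 1 <;> simp [hk, hh]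
    have hk0 : ∀ h, |h| ≤ 1 → k h = 0 := fun h hh => by simp [hk, hh]
    have hint : ∀ s : ℝ, |s| = 1 →
        IntegrableOn (fun h => k (s * h) * ((h ^ (-α - 1) : ℝ) : ℂ)) (Ioi 0) := fun s hs => by
      refine integrableOn_Ioi_of_le_rpow (C := 0) (D := 1) (p := 0) (q := -α) (by fun_prop)
        (by norm_num) (by linarith) (fun h hh hh1 => ?_) (fun h hh => ?_)
      · rw [hk0 _ (by rwa [abs_mul, hs, one_mul, abs_of_pos hh])]
        simp
      · have hh' : 0 < h := zero_lt_one.trans hh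
        rw [norm_mul_rpow_ofReal _ hh'.le]
        have h2 := hkb (s * h)
        rw [abs_mul, hs, one_mul, abs_of_pos hh'] at h2
        calc _ ≤ h * h ^ (-α - 1) := by gcongr
          _ = 1 * h ^ (-α) := by rw [Real.rpow_sub_one hh'.ne']; field_simp
    have hki := (stableLevyMeasure_integral hneg hpos (f := k) (α := α)
      (by simpa using hint 1 (by simp)) (by simpa using hint (-1) (by simp))).1
    refine ⟨Complex.I * b + ∫ h, k h ∂stableLevyMeasure α cneg cpos, fun u => ?_⟩
    rcases eq_or_ne u 0 with rfl | hu
    · simp [levyKhintchineExponent_zero, stableExponent_zero hα.1.ne']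
    obtain ⟨hi, he⟩ := stableLevyMeasure_integral_exp_sub_one_sub h1 hα.2 hneg hpos hu
    have hsplit : ∫ h : ℝ, (Complex.exp (Complex.I * u * h) - 1 -
        (if |h| ≤ 1 then Complex.I * u * h else 0)) ∂stableLevyMeasure α cneg cpos =
        stableExponent α cneg cpos u + u * ∫ h, k h ∂stableLevyMeasure α cneg cpos := by
      rw [← he, ← integral_const_mul, ← integral_add hi (hki.const_mul _)]
      refine integral_congr_ae (Eventually.of_forall fun h => ?_)
      by_cases hh : |h| ≤ 1
      · simp only [hk, if_pos hh]; ring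
      · simp only [hk, if_neg hh]; ring
    rw [levyKhintchineExponent, hsplit]
    ring

theorem eq_of_forall_exp_mul_eq {A B : ℂ}
    (h : ∀ t : ℝ, 0 ≤ t → Complex.exp (t * A) = Complex.exp (t * B)) : A = B := by
  have hd : ∀ C : ℂ, HasDerivWithinAt (fun t : ℝ => Complex.exp (t * C)) C (Ici 0) 0 := fun C => by
    have h1 : HasDerivAt (fun t : ℝ => (t : ℂ) * C) (((1 : ℝ) : ℂ) * C) 0 :=
      (hasDerivAt_id (0 : ℝ)).ofReal_comp.mul_const C
    simpa using h1.cexp.hasDerivWithinAt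
  refine UniqueDiffWithinAt.eq_deriv (Ici (0 : ℝ)) (uniqueDiffWithinAt_Ici 0) (hd A) ?_
  exact (hd B).congr (fun t ht => h t ht) (h 0 le_rfl)

/-- A sum of a linear and a quadratic term cannot scale with an exponent other than one and two. -/
theorem sub_eq_zero_of_scaling {α : ℝ} (hα : α ∈ Ioo (0 : ℝ) 2) (hα1 : α ≠ 1) {p q : ℂ}
    (h : ∀ r : ℝ, 0 < r → p * r - q * r ^ 2 = ((r ^ α : ℝ) : ℂ) * (p - q)) : p - q = 0 := by
  -- The relations for `r = 2` and `r = 4` involve only `t = 2 ^ α` and suffice.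
  set t : ℝ := 2 ^ α with ht
  have ht2 : t ≠ 2 := fun h2 => hα1 <| by
    have h3 : (2 : ℝ) ^ α = 2 ^ (1 : ℝ) := by rw [Real.rpow_one]; exact h2
    exact (Real.rpow_right_inj two_pos (by norm_num)).1 h3
  have ht4 : t ≠ 4 := fun h2 => hα.2.ne <| by
    have h3 : (2 : ℝ) ^ α = 2 ^ (2 : ℝ) := by rw [Real.rpow_two]; norm_num; exact h2
    exact (Real.rpow_right_inj two_pos (by norm_num)).1 h3
  have h2 := h 2 two_pos
  have h4 := h 4 (by norm_num)
  have h44 : (4 : ℝ) ^ α = t ^ 2 := by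
    rw [show (4 : ℝ) = 2 * 2 by norm_num, Real.mul_rpow two_pos.le two_pos.le, sq]
  rw [← ht] at h2
  rw [h44] at h4
  push_cast at h2 h4
  have ht2' : (t : ℂ) - 2 ≠ 0 := sub_ne_zero.2 (by exact_mod_cast ht2)
  have ht4' : (t : ℂ) - 4 ≠ 0 := sub_ne_zero.2 (by exact_mod_cast ht4)
  have hq : q * ((t : ℂ) - 4) = 0 := by linear_combination (-(t + 2) * h2 + h4) / 2
  have hq0 : q = 0 := (mul_eq_zero.1 hq).resolve_right ht4'
  rw [hq0] at h2
  have hp : p * ((t : ℂ) - 2) = 0 := by linear_combination -h2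
  rw [hq0, (mul_eq_zero.1 hp).resolve_right ht2', sub_zero]

/-- Strict stability removes the drift and the Gaussian part left over by the Lévy–Khintchine
formula, because they scale differently from the jump part. -/
theorem IsStrictlyStable.charFun_eq {Ω : Type*} [MeasurableSpace Ω] {P : Measure Ω}
    {X : ℝ≥0 → Ω → ℝ} {α cneg cpos : ℝ} (hX : IsStrictlyStable X P α cneg cpos)
    (hα : α ∈ Ioo (0 : ℝ) 2) (hα1 : α ≠ 1) (hneg : 0 ≤ cneg) (hpos : 0 ≤ cpos)
    (t : ℝ≥0) (u : ℝ) :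
    charFun (P.map (X t)) u = Complex.exp ((t : ℝ) * stableExponent α cneg cpos u) := by
  obtain ⟨-, -, a, b, -, h⟩ := hX.levyMeasure
  obtain ⟨B, hB⟩ := exists_levyKhintchineExponent_eq hα hα1 hneg hpos a b
  set η := levyKhintchineExponent a b (stableLevyMeasure α cneg cpos) with hη
  have hscale : ∀ r : ℝ, 0 < r → η (r * u) = ((r ^ α : ℝ) : ℂ) * η u := fun r hr => by
    refine (eq_of_forall_exp_mul_eq fun s hs => ?_).symm
    lift s to ℝ≥0 using hs
    obtain ⟨c, hc⟩ : ∃ c : ℝ≥0, (c : ℝ) = r ^ α := CanLift.prf _ (Real.rpow_nonneg hr.le α)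
    have hc0 : 0 < c := by
      rw [← NNReal.coe_pos, hc]
      exact Real.rpow_pos_of_pos hr α
    have h1 : charFun (P.map (X (c * s))) u =
        charFun (P.map fun ω => (c : ℝ) ^ (1 / α) * X s ω) u := by
      rw [hX.scaling c s hc0]
    rw [charFun_map_mul_comp (hX.levy.measurable s).aemeasurable, h, h, hc,
      ← Real.rpow_mul hr.le, mul_one_div_cancel hα.1.ne', Real.rpow_one] at h1
    rw [← h1, NNReal.coe_mul, hc, Complex.ofReal_mul, mul_left_comm, mul_assoc]
  rw [h]
  congr 2
  rcases eq_or_ne u 0 with rfl | hu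
  · rw [stableExponent_zero hα.1.ne', hη, levyKhintchineExponent_zero]
  have hzero := sub_eq_zero_of_scaling hα hα1 (p := B * u) (q := a * u ^ 2 / 2) fun r hr => by
    have h1 := hscale r hr
    rw [hB, hB, stableExponent_mul α cneg cpos hr hu] at h1
    push_cast at h1 ⊢
    linear_combination h1
  rw [hB, hzero, zero_add]

/-! ### The generator -/

/-- Fourier inversion and Fubini's theorem express the transition semigroup on `Φ` through the
characteristic function. -/
theorem integral_lizorkin_add {Ω : Type*} [MeasurableSpace Ω] {P : Measure Ω}
    [IsProbabilityMeasure P] {Y : Ω → ℝ} (hY : Measurable Y) (φ : lizorkin) (x : ℝ) :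
    ∫ ω, (φ : 𝓢(ℝ, ℂ)) (x + Y ω) ∂P =
      ∫ ξ : ℝ, Complex.exp (2 * Real.pi * Complex.I * ξ * x) *
        (charFun (P.map Y) (2 * Real.pi * ξ) * (lizorkinFourier φ : 𝓢(ℝ, ℂ)) ξ) := by
  set ψ : 𝓢(ℝ, ℂ) := (lizorkinFourier φ).1
  have hint := ((integrable_const (1 : ℂ) (μ := P)).mul_prod (ψ.integrable (μ := volume))).bdd_mul
    (c := 1)
    (f := fun p : Ω × ℝ => Complex.exp (((2 * Real.pi * p.2 * (x + Y p.1) : ℝ) : ℂ) * Complex.I))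
    (Measurable.aestronglyMeasurable (by fun_prop))
    (Eventually.of_forall fun p => (Complex.norm_exp_ofReal_mul_I _).le)
  have hswap := integral_integral_swap
    (f := fun (ω : Ω) (ξ : ℝ) =>
      Complex.exp (((2 * Real.pi * ξ * (x + Y ω) : ℝ) : ℂ) * Complex.I) * (1 * ψ ξ)) hint
  calc _ = ∫ ω, (∫ ξ : ℝ,
        Complex.exp (((2 * Real.pi * ξ * (x + Y ω) : ℝ) : ℂ) * Complex.I) * (1 * ψ ξ)) ∂P := by
        refine integral_congr_ae (Eventually.of_forall fun ω => ?_)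
        simp only
        rw [lizorkin_eq_integral]
        refine integral_congr_ae (Eventually.of_forall fun ξ => ?_)
        simp only
        rw [show 2 * Real.pi * Complex.I * ξ * ((x + Y ω : ℝ) : ℂ) =
          ((2 * Real.pi * ξ * (x + Y ω) : ℝ) : ℂ) * Complex.I by push_cast; ring, one_mul]
    _ = _ := hswap
    _ = _ := by
        refine integral_congr_ae (Eventually.of_forall fun ξ => ?_)
        simp only
        rw [charFun_apply_real, integral_map hY.aemeasurable
          (Measurable.aestronglyMeasurable (by fun_prop)), ← integral_mul_const,
          ← integral_const_mul]
        refine integral_congr_ae (Eventually.of_forall fun ω => ?_)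
        simp only
        rw [show ((2 * Real.pi * ξ * (x + Y ω) : ℝ) : ℂ) * Complex.I =
            2 * Real.pi * Complex.I * ξ * x + ((2 * Real.pi * ξ : ℝ) : ℂ) * Y ω * Complex.I by
              push_cast; ring, Complex.exp_add]
        ring

theorem tendsto_exp_mul_sub_one_div (w : ℂ) :
    Tendsto (fun t : ℝ≥0 => (Complex.exp ((t : ℝ) * w) - 1) / ((t : ℝ) : ℂ)) (𝓝[>] 0) (𝓝 w) := by
  have h1 : HasDerivAt (fun t : ℝ => Complex.exp ((t : ℂ) * w)) w 0 := by
    have h2 : HasDerivAt (fun t : ℝ => (t : ℂ) * w) (((1 : ℝ) : ℂ) * w) 0 :=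
      (hasDerivAt_id (0 : ℝ)).ofReal_comp.mul_const w
    simpa using h2.cexp
  have h2 := hasDerivAt_iff_tendsto_slope.1 h1
  have h3 : Tendsto (fun t : ℝ≥0 => (t : ℝ)) (𝓝[>] 0) (𝓝[≠] 0) := by
    refine tendsto_nhdsWithin_of_tendsto_nhds_of_eventually_within _ ?_ ?_
    · exact (NNReal.continuous_coe.tendsto 0).mono_left nhdsWithin_le_nhds
    · filter_upwards [self_mem_nhdsWithin] with t ht
      have : (0 : ℝ) < t := ht
      exact this.ne'
  refine (h2.comp h3).congr fun t => ?_
  simp [slope, div_eq_inv_mul]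

theorem norm_exp_mul_sub_one_div_le {w : ℂ} (hw : w.re ≤ 0) {t : ℝ} (ht : 0 < t) :
    ‖(Complex.exp (t * w) - 1) / (t : ℂ)‖ ≤ ‖w‖ := by
  have h := norm_exp_sub_one_le_norm (w := t * w)
    (by simpa using mul_nonpos_of_nonneg_of_nonpos ht.le hw)
  rw [norm_mul, Complex.norm_real, Real.norm_of_nonneg ht.le] at h
  rw [norm_div, Complex.norm_real, Real.norm_of_nonneg ht.le, div_le_iff₀ ht, mul_comm ‖w‖]
  exact h

/-- If the characteristic functions of `X_t` are `exp(tη)` and `η(2πξ)` is a homogeneous symbol, the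
generator acts on `Φ` as the multiplier with this symbol: the difference quotients converge
uniformly since the Fourier transforms converge in `L¹`. -/
theorem hasGenerator_homMultiplier {Ω : Type*} [MeasurableSpace Ω] {P : Measure Ω}
    [IsProbabilityMeasure P] {X : ℝ≥0 → Ω → ℝ} (hX : ∀ t, Measurable (X t)) {η : ℝ → ℂ}
    (hη : ∀ (t : ℝ≥0) (u : ℝ), charFun (P.map (X t)) u = Complex.exp ((t : ℝ) * η u))
    {a b : ℂ} {s : ℝ} (hs : ∀ ξ : ℝ, η (2 * Real.pi * ξ) = homSymbol a b s ξ) (φ : lizorkin) :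
    HasGenerator X P (φ : 𝓢(ℝ, ℂ)) (homMultiplier a b s φ : 𝓢(ℝ, ℂ)) := by
  set ψ : 𝓢(ℝ, ℂ) := (lizorkinFourier φ).1 with hψ
  set H := homSymbol a b s with hH
  have hHψ : Integrable fun ξ => H ξ * ψ ξ := integrable_homSymbol_mul a b s (lizorkinFourier φ)
  -- A characteristic function is bounded by one, so its exponent has nonpositive real part.
  have hre : ∀ ξ, (H ξ).re ≤ 0 := fun ξ => by
    have : IsProbabilityMeasure (P.map (X 1)) :=
      Measure.isProbabilityMeasure_map (hX 1).aemeasurable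
    have h1 := norm_charFun_le_one (μ := P.map (X 1)) (2 * Real.pi * ξ)
    rw [hη, hs, Complex.norm_exp, Real.exp_le_one_iff] at h1
    simpa using h1
  have hHm : Measurable H := by
    refine Measurable.ite measurableSet_Ioi (by fun_prop)
      (Measurable.ite measurableSet_Iio (by fun_prop) measurable_const)
  have hψm : Measurable ψ := ψ.continuous.measurable
  set q : ℝ≥0 → ℝ → ℂ := fun t ξ => (Complex.exp ((t : ℝ) * H ξ) - 1) / ((t : ℝ) : ℂ) with hq
  have hqm : ∀ t, Measurable (q t) := fun t => by fun_prop
  have hqb : ∀ t : ℝ≥0, 0 < t → ∀ ξ, ‖q t ξ‖ ≤ ‖H ξ‖ := fun t ht ξ =>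
    norm_exp_mul_sub_one_div_le (hre ξ) (by exact_mod_cast ht)
  have hqψ : ∀ t : ℝ≥0, 0 < t → Integrable fun ξ => q t ξ * ψ ξ := fun t ht => by
    refine hHψ.mono ((hqm t).mul hψm).aestronglyMeasurable (Eventually.of_forall fun ξ => ?_)
    rw [norm_mul, norm_mul]
    gcongr
    exact hqb t ht ξ
  have hlim : Tendsto (fun t : ℝ≥0 => ∫ ξ, ‖(H ξ - q t ξ) * ψ ξ‖) (𝓝[>] 0) (𝓝 0) := by
    have h0 : (∫ ξ : ℝ, ‖(H ξ - H ξ) * ψ ξ‖) = 0 := by simp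
    rw [← h0]
    refine tendsto_integral_filter_of_dominated_convergence (fun ξ => 2 * ‖H ξ * ψ ξ‖) ?_ ?_
      (hHψ.norm.const_mul 2) ?_
    · exact Eventually.of_forall fun t =>
        ((hHm.sub (hqm t)).mul hψm).norm.aestronglyMeasurable
    · filter_upwards [self_mem_nhdsWithin] with t ht
      refine Eventually.of_forall fun ξ => ?_
      rw [norm_norm, norm_mul, norm_mul, ← mul_assoc]
      gcongr
      refine (norm_sub_le _ _).trans ?_
      linarith [hqb t ht ξ]
    · exact Eventually.of_forall fun ξ =>
        ((tendsto_const_nhds.sub (tendsto_exp_mul_sub_one_div (H ξ))).mul_const _).norm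
  have hnorm : ∀ ξ x : ℝ, ‖Complex.exp (2 * Real.pi * Complex.I * ξ * x)‖ = 1 := fun ξ x => by
    rw [← Complex.norm_exp_ofReal_mul_I (2 * Real.pi * ξ * x)]
    congr 2
    push_cast
    ring
  have hmul : ∀ (f : ℝ → ℂ) (x : ℝ), Integrable f →
      Integrable fun ξ : ℝ => Complex.exp (2 * Real.pi * Complex.I * ξ * x) * f ξ :=
    fun f x hf => hf.bdd_mul (c := 1) (Measurable.aestronglyMeasurable (by fun_prop))
      (Eventually.of_forall fun ξ => (hnorm ξ x).le)
  refine Metric.tendstoUniformly_iff.2 fun ε hε => ?_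
  filter_upwards [self_mem_nhdsWithin, hlim.eventually (gt_mem_nhds hε)] with t ht hδ x
  have ht0 : ((t : ℝ) : ℂ) ≠ 0 := by
    have h1 : (0 : ℝ≥0) < t := ht
    exact_mod_cast h1.ne'
  refine lt_of_le_of_lt ?_ hδ
  have hE : ((∫ ω, (φ : 𝓢(ℝ, ℂ)) (x + X t ω) ∂P) - (φ : 𝓢(ℝ, ℂ)) x) / ((t : ℝ) : ℂ) =
      ∫ ξ : ℝ, Complex.exp (2 * Real.pi * Complex.I * ξ * x) * (q t ξ * ψ ξ) := by
    have h2 : ∀ ξ : ℝ, Complex.exp (2 * Real.pi * Complex.I * ξ * x) *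
        (charFun (P.map (X t)) (2 * Real.pi * ξ) * ψ ξ) =
        ((t : ℝ) : ℂ) * (Complex.exp (2 * Real.pi * Complex.I * ξ * x) * (q t ξ * ψ ξ)) +
          Complex.exp (2 * Real.pi * Complex.I * ξ * x) * ψ ξ := fun ξ => by
      rw [hη, hs, hq]
      field_simp
      ring
    rw [integral_lizorkin_add (hX t), lizorkin_eq_integral φ x,
      integral_congr_ae (Eventually.of_forall h2),
      integral_add ((hmul _ x (hqψ t ht)).const_mul _) (hmul _ x ψ.integrable),
      integral_const_mul, add_sub_cancel_right, mul_div_cancel_left₀ _ ht0]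
  rw [hE, homMultiplier_apply, dist_eq_norm,
    ← integral_sub (hmul _ x hHψ) (hmul _ x (hqψ t ht))]
  refine (norm_integral_le_integral_norm _).trans (le_of_eq ?_)
  refine integral_congr_ae (Eventually.of_forall fun ξ => ?_)
  simp only
  rw [← mul_sub, norm_mul, hnorm, one_mul, sub_mul]

/-! ### Real-valued functions -/

theorem HasGenerator.im_eq_zero {Ω : Type*} [MeasurableSpace Ω] {P : Measure Ω}
    {X : ℝ≥0 → Ω → ℝ} {f g : ℝ → ℂ} (h : HasGenerator X P f g) (hf : ∀ x, (f x).im = 0) (x : ℝ) :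
    (g x).im = 0 := by
  refine (isClosed_singleton.preimage Complex.continuous_im).mem_of_tendsto (s := _)
    (h.tendsto_at x) (Eventually.of_forall fun t => ?_)
  have hf' : ∀ y, f y = ((f y).re : ℂ) := fun y => Complex.ext rfl (hf y)
  simp only [mem_preimage, mem_singleton_iff]
  rw [integral_congr_ae (Eventually.of_forall fun ω => hf' (x + X t ω)), integral_complex_ofReal,
    hf' x, ← Complex.ofReal_sub, ← Complex.ofReal_div, Complex.ofReal_im]

theorem leftFracInt_im {β : ℝ} {f : ℝ → ℂ} (hf : ∀ x, (f x).im = 0) (x : ℝ) :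
    (leftFracInt β f x).im = 0 := by
  have hf' : ∀ y, f y = ((f y).re : ℂ) := fun y => Complex.ext rfl (hf y)
  have h : ∀ t, leftKernel β f x t = (((x - t) ^ (β - 1) * (f t).re : ℝ) : ℂ) := fun t => by
    rw [leftKernel, hf' t]
    simp
  rw [leftFracInt]
  split_ifs
  · exact hf x
  · rw [integral_congr_ae (Eventually.of_forall h), integral_complex_ofReal, ← Complex.ofReal_mul,
      Complex.ofReal_im]

theorem rightFracInt_im {β : ℝ} {f : ℝ → ℂ} (hf : ∀ x, (f x).im = 0) (x : ℝ) :
    (rightFracInt β f x).im = 0 := by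
  have hf' : ∀ y, f y = ((f y).re : ℂ) := fun y => Complex.ext rfl (hf y)
  have h : ∀ t, rightKernel β f x t = (((t - x) ^ (β - 1) * (f t).re : ℝ) : ℂ) := fun t => by
    rw [rightKernel, hf' t]
    simp
  rw [rightFracInt]
  split_ifs
  · exact hf x
  · rw [integral_congr_ae (Eventually.of_forall h), integral_complex_ofReal, ← Complex.ofReal_mul,
      Complex.ofReal_im]

/-! ### Inversion of the symbol -/

/-- The two branches of `(±2πi)^α` have argument `±πα/2`, whence the cosine in `stableDenom`. -/
theorem cpow_div_cpow_add (α : ℝ) :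
    (2 * Real.pi * Complex.I) ^ (α : ℂ) / (-(2 * Real.pi * Complex.I)) ^ (α : ℂ) +
      (-(2 * Real.pi * Complex.I)) ^ (α : ℂ) / (2 * Real.pi * Complex.I) ^ (α : ℂ) =
      2 * (Real.cos (Real.pi * α) : ℂ) := by
  have hz := Complex.two_pi_I_ne_zero
  have hl : Complex.log (2 * Real.pi * Complex.I) =
      Real.log (2 * Real.pi) + Real.pi / 2 * Complex.I := by
    have := Complex.log_ofReal_mul Real.two_pi_pos Complex.I_ne_zero
    rw [Complex.log_I] at this
    rw [← this]
    push_cast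
    rfl
  have hl' : Complex.log (-(2 * Real.pi * Complex.I)) =
      Real.log (2 * Real.pi) - Real.pi / 2 * Complex.I := by
    have := Complex.log_ofReal_mul Real.two_pi_pos (neg_ne_zero.2 Complex.I_ne_zero)
    rw [Complex.log_neg_I] at this
    rw [show -(2 * Real.pi * Complex.I) = ((2 * Real.pi : ℝ) : ℂ) * -Complex.I by push_cast; ring,
      this]
    ring
  rw [Complex.cpow_def_of_ne_zero hz, Complex.cpow_def_of_ne_zero (neg_ne_zero.2 hz), hl, hl',
    ← Complex.exp_sub, ← Complex.exp_sub, Complex.ofReal_cos, Complex.two_cos]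
  congr 2 <;> · push_cast; ring

theorem stableDenom_pos {α cneg cpos : ℝ} (hα : α ∈ Ioo (0 : ℝ) 2) (hα1 : α ≠ 1)
    (hneg : 0 ≤ cneg) (hpos : 0 ≤ cpos) (hc : ¬(cneg = 0 ∧ cpos = 0)) :
    0 < stableDenom α cneg cpos := by
  have hΓ : Real.Gamma (-α) ≠ 0 := Real.Gamma_ne_zero fun m hm => by
    have hm' : α = m := by linarith
    have h0 := hα.1
    have h2 := hα.2
    rw [hm'] at h0 h2 hα1
    have h3 : 0 < m := by exact_mod_cast h0
    have h4 : m < 2 := by exact_mod_cast h2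
    have h5 : m = 1 := by omega
    exact hα1 (by exact_mod_cast h5)
  have hcos : -1 < Real.cos (Real.pi * α) := by
    refine lt_of_le_of_ne (Real.neg_one_le_cos _) fun h => hα1 ?_
    obtain ⟨k, hk⟩ := Real.cos_eq_neg_one_iff.1 h.symm
    have hk' : α = 1 + 2 * k := by
      have := Real.pi_pos.ne'
      apply mul_left_cancel₀ this
      linarith
    have h0 := hα.1
    have h2 := hα.2
    rw [hk'] at h0 h2
    have h3 : -1 < 2 * k := by exact_mod_cast (by linarith : (-1 : ℝ) < 2 * k)
    have h4 : 2 * k < 1 := by exact_mod_cast (by linarith : (2 * k : ℝ) < 1)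
    have h5 : k = 0 := by omega
    rw [hk', h5]
    simp
  have hΓ2 : 0 < Real.Gamma (-α) ^ 2 := by positivity
  have h : stableDenom α cneg cpos = Real.Gamma (-α) ^ 2 *
      ((cneg - cpos) ^ 2 + 2 * (cneg * cpos) * (1 + Real.cos (Real.pi * α))) := by
    simp only [stableDenom, stableM]
    ring
  rw [h]
  refine mul_pos hΓ2 ?_
  have hcos' : 0 < 1 + Real.cos (Real.pi * α) := by linarith
  rcases eq_or_ne cneg cpos with rfl | hne
  · have h0 : 0 < cneg := lt_of_le_of_ne hneg fun h => hc ⟨h.symm, h.symm⟩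
    positivity
  · have h0 : 0 < (cneg - cpos) ^ 2 := by
      have := sub_ne_zero.2 hne
      positivity
    positivity

theorem mul_inv_symbol_eq_one {M N D p q c : ℂ} (hp : p ≠ 0) (hq : q ≠ 0) (hD : D ≠ 0)
    (hDeq : D = M ^ 2 + N ^ 2 + 2 * M * N * c) (hc : p / q + q / p = 2 * c) :
    (M * p + N * q) * (M / D * p⁻¹ + N / D * q⁻¹) = 1 := by
  have h : (M * p + N * q) * (M * p⁻¹ + N * q⁻¹) = D := by
    have : (M * p + N * q) * (M * p⁻¹ + N * q⁻¹) = M ^ 2 + N ^ 2 + M * N * (p / q + q / p) := by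
      field_simp
      ring
    rw [this, hc, hDeq]
    ring
  calc _ = (M * p + N * q) * (M * p⁻¹ + N * q⁻¹) / D := by ring
    _ = 1 := by rw [h, div_self hD]

/-- The multiplier `a (2πiξ)^s + b (-2πiξ)^s`, a combination of left and right fractional
derivatives or integrals. -/
def fracMultiplier (a b : ℂ) (s : ℝ) : lizorkin →ₗ[ℂ] lizorkin :=
  homMultiplier
    (a * (2 * Real.pi * Complex.I) ^ (s : ℂ) + b * (-(2 * Real.pi * Complex.I)) ^ (s : ℂ))
    (a * (-(2 * Real.pi * Complex.I)) ^ (s : ℂ) + b * (2 * Real.pi * Complex.I) ^ (s : ℂ)) s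

theorem fracMultiplier_apply (a b : ℂ) (s : ℝ) (φ : lizorkin) (x : ℝ) :
    (fracMultiplier a b s φ : 𝓢(ℝ, ℂ)) x =
      a * (powMultiplier (2 * Real.pi * Complex.I) s φ : 𝓢(ℝ, ℂ)) x +
        b * (powMultiplier (-(2 * Real.pi * Complex.I)) s φ : 𝓢(ℝ, ℂ)) x := by
  rw [fracMultiplier, homMultiplier_add, homMultiplier_const_mul, homMultiplier_const_mul,
    powMultiplier, powMultiplier, neg_neg]
  rfl

theorem fracMultiplier_comp_eq_id {M N D : ℝ} {s : ℝ} (hD : D ≠ 0)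
    (hDeq : D = M ^ 2 + N ^ 2 + 2 * M * N * Real.cos (Real.pi * s)) (φ : lizorkin) :
    fracMultiplier M N s (fracMultiplier (M / D : ℝ) (N / D : ℝ) (-s) φ) = φ ∧
      fracMultiplier (M / D : ℝ) (N / D : ℝ) (-s) (fracMultiplier M N s φ) = φ := by
  have hz := Complex.two_pi_I_ne_zero
  set p := (2 * Real.pi * Complex.I) ^ (s : ℂ) with hp
  set q := (-(2 * Real.pi * Complex.I)) ^ (s : ℂ) with hq
  have hp0 : p ≠ 0 := by simp [hp, Complex.cpow_eq_zero_iff, hz]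
  have hq0 : q ≠ 0 := by simp [hq, Complex.cpow_eq_zero_iff, hz]
  have hDC : (D : ℂ) ≠ 0 := by exact_mod_cast hD
  have hDC' : (D : ℂ) = M ^ 2 + N ^ 2 + 2 * M * N * (Real.cos (Real.pi * s) : ℂ) := by
    exact_mod_cast hDeq
  have hpq := cpow_div_cpow_add s
  rw [← hp, ← hq] at hpq
  have h1 := mul_inv_symbol_eq_one hp0 hq0 hDC hDC' hpq
  have h2 := mul_inv_symbol_eq_one hq0 hp0 hDC hDC' (by rw [add_comm]; exact hpq)
  have hps : (2 * Real.pi * Complex.I) ^ ((-s : ℝ) : ℂ) = p⁻¹ := by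
    rw [Complex.ofReal_neg, Complex.cpow_neg]
  have hqs : (-(2 * Real.pi * Complex.I)) ^ ((-s : ℝ) : ℂ) = q⁻¹ := by
    rw [Complex.ofReal_neg, Complex.cpow_neg]
  constructor
  · rw [fracMultiplier, fracMultiplier, homMultiplier_homMultiplier, hps, hqs, ← hp, ← hq,
      Complex.ofReal_div, Complex.ofReal_div, h1, h2, add_neg_cancel, homMultiplier_one]
  · rw [fracMultiplier, fracMultiplier, homMultiplier_homMultiplier, hps, hqs, ← hp, ← hq,
      Complex.ofReal_div, Complex.ofReal_div, mul_comm, h1, mul_comm, h2, neg_add_cancel,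
      homMultiplier_one]

theorem stableExponent_two_pi_mul {α : ℝ} (hα : α ≠ 0) (cneg cpos ξ : ℝ) :
    stableExponent α cneg cpos (2 * Real.pi * ξ) =
      homSymbol
        (stableM α cneg * (2 * Real.pi * Complex.I) ^ (α : ℂ) +
          stableM α cpos * (-(2 * Real.pi * Complex.I)) ^ (α : ℂ))
        (stableM α cneg * (-(2 * Real.pi * Complex.I)) ^ (α : ℂ) +
          stableM α cpos * (2 * Real.pi * Complex.I) ^ (α : ℂ)) α ξ := by
  have hz := Complex.two_pi_I_ne_zero
  rcases eq_or_ne ξ 0 with rfl | hξ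
  · rw [mul_zero, stableExponent_zero hα, homSymbol_zero]
  have h := homSymbol_cpow (neg_ne_zero.2 hz) α hξ
  rw [neg_neg] at h
  rw [homSymbol_add, homSymbol_const_mul, homSymbol_const_mul, homSymbol_cpow hz α hξ, h,
    stableExponent]
  push_cast
  ring_nf

theorem lt_natCeil_of_ne_one {α : ℝ} (hα : α ∈ Ioo (0 : ℝ) 2) (hα1 : α ≠ 1) : α < ⌈α⌉₊ := by
  refine lt_of_le_of_ne (Nat.le_ceil α) fun h => ?_
  have h0 : (0 : ℝ) < ⌈α⌉₊ := h ▸ hα.1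
  have h2 : (⌈α⌉₊ : ℝ) < 2 := h ▸ hα.2
  have h0' : 0 < ⌈α⌉₊ := by exact_mod_cast h0
  have h2' : ⌈α⌉₊ < 2 := by exact_mod_cast h2
  have h1 : ⌈α⌉₊ = 1 := by omega
  rw [h1] at h
  exact hα1 (by exact_mod_cast h)

end

theorem theorem1 {Ω : Type*} [MeasurableSpace Ω] (P : Measure Ω) [IsProbabilityMeasure P]
    (X : ℝ≥0 → Ω → ℝ) (α cneg cpos : ℝ)
    (hα : α ∈ Ioo (0 : ℝ) 2) (hα1 : α ≠ 1)
    (hneg : 0 ≤ cneg) (hpos : 0 ≤ cpos) (hc : ¬(cneg = 0 ∧ cpos = 0))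
    (hX : IsStrictlyStable X P α cneg cpos) :
    -- the fractional operators below are well defined on `Φ`
    (∀ φ ∈ lizorkin, ∀ β : ℝ, 0 < β → ∀ x : ℝ,
      IntegrableOn (leftKernel β φ x) (Iio x) volume ∧ IntegrableOn (rightKernel β φ x) (Ioi x) volume) ∧
    (∀ φ ∈ lizorkin, ContDiff ℝ ⌈α⌉₊ (leftFracInt (⌈α⌉₊ - α) φ) ∧
      ContDiff ℝ ⌈α⌉₊ (rightFracInt (⌈α⌉₊ - α) φ)) ∧
    -- the generator is an invertible linear operator of `Φ`
    ∃ L : lizorkin ≃ₗ[ℂ] lizorkin,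
      (∀ φ : lizorkin, HasGenerator X P (φ : 𝓢(ℝ, ℂ)) (L φ : 𝓢(ℝ, ℂ))) ∧
      (∀ (φ : lizorkin) (x : ℝ), (L φ : 𝓢(ℝ, ℂ)) x =
        stableM α cneg * leftFracDeriv α (φ : 𝓢(ℝ, ℂ)) x +
          stableM α cpos * rightFracDeriv α (φ : 𝓢(ℝ, ℂ)) x) ∧
      (∀ (φ : lizorkin) (x : ℝ), (L.symm φ : 𝓢(ℝ, ℂ)) x =
        stableKneg α cneg cpos * leftFracInt α (φ : 𝓢(ℝ, ℂ)) x +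
          stableKpos α cneg cpos * rightFracInt α (φ : 𝓢(ℝ, ℂ)) x) ∧
      -- it restricts to a bijection of the real-valued functions in `Φ`
      (∀ φ : lizorkin, (∀ x : ℝ, ((φ : 𝓢(ℝ, ℂ)) x).im = 0) ↔
        ∀ x : ℝ, ((L φ : 𝓢(ℝ, ℂ)) x).im = 0) := by
  have hceil := lt_natCeil_of_ne_one hα hα1
  have hD := stableDenom_pos hα hα1 hneg hpos hc
  refine ⟨fun φ _ β hβ x => ⟨integrableOn_leftKernel hβ φ x, integrableOn_rightKernel hβ φ x⟩,
    fun φ hφ => ⟨?_, ?_⟩, ?_⟩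
  · rw [leftFracInt_lizorkin (sub_pos.2 hceil) ⟨φ, hφ⟩]
    exact SchwartzMap.smooth _ ⌈α⌉₊
  · rw [rightFracInt_lizorkin (sub_pos.2 hceil) ⟨φ, hφ⟩]
    exact SchwartzMap.smooth _ ⌈α⌉₊
  let L : lizorkin ≃ₗ[ℂ] lizorkin := LinearEquiv.ofLinearMap
    (fracMultiplier (stableM α cneg) (stableM α cpos) α)
    (fracMultiplier (stableKneg α cneg cpos) (stableKpos α cneg cpos) (-α))
    (LinearMap.ext fun φ => (fracMultiplier_comp_eq_id hD.ne' rfl φ).1)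
    (LinearMap.ext fun φ => (fracMultiplier_comp_eq_id hD.ne' rfl φ).2)
  have hgen : ∀ φ : lizorkin, HasGenerator X P (φ : 𝓢(ℝ, ℂ)) (L φ : 𝓢(ℝ, ℂ)) := fun φ =>
    hasGenerator_homMultiplier hX.levy.measurable
      (fun t u => hX.charFun_eq hα hα1 hneg hpos t u)
      (fun ξ => stableExponent_two_pi_mul hα.1.ne' cneg cpos ξ) φ
  have hsymm : ∀ (φ : lizorkin) (x : ℝ), (L.symm φ : 𝓢(ℝ, ℂ)) x =
      stableKneg α cneg cpos * leftFracInt α (φ : 𝓢(ℝ, ℂ)) x +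
        stableKpos α cneg cpos * rightFracInt α (φ : 𝓢(ℝ, ℂ)) x := fun φ x => by
    rw [leftFracInt_lizorkin hα.1, rightFracInt_lizorkin hα.1]
    exact fracMultiplier_apply _ _ _ _ _
  refine ⟨L, hgen, fun φ x => ?_, hsymm, fun φ => ⟨fun h => (hgen φ).im_eq_zero h, fun h x => ?_⟩⟩
  · rw [leftFracDeriv_lizorkin hceil, rightFracDeriv_lizorkin hceil]
    exact fracMultiplier_apply _ _ _ _ _
  · have h1 := hsymm (L φ) x
    rw [L.symm_apply_apply] at h1
    rw [h1, Complex.add_im, Complex.im_ofReal_mul, Complex.im_ofReal_mul, leftFracInt_im h,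
      rightFracInt_im h, mul_zero, mul_zero, add_zero]
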